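/- Conventions. Machines are partial recursive functions on binary strings and $\log=\log_2$. A machine $U$ is *standard* if for every machine $V$ there is a polynomial-time computable $t$ with $U(t(p))=V(p)$ for all $p$ and $|t(p)|\le |p|+O(1)$. For a fixed standard $U$ let $C(x)=\min\{|p| : U(p)=x\}$; a string $p$ is a *$c$-short program* for $x$ if $U(p)=x$ and $|p|\le C(x)+c$. A *probabilistic algorithm that list-approximates short programs* with list size $T$, $r$ random bits and closeness $c$, where $T,r,c:\mathbb N\to\mathbb N$ are functions of the input length $n=|x|$ and $r,c$ are computable, is an algorithm $F$ such that for every $x$ of every length $n$: for all $\rho\in\{0,1\}^{r(n)}$, $F(x,\rho)$ halts and outputs a finite set $L_{x,\rho}$ of exactly $T(n)$ strings; and for at least half of the $\rho\in\{0,1\}^{r(n)}$, the set $L_{x,\rho}$ contains a $c(n)$-short program for $x$. **Theorem.** Let $U$ be a standard machine. There are constants $K$ and $a>0$, depending only on $U$, such that for every probabilistic algorithm that list-approximates short programs, with parameters $T,r,c$, the following hold. (1) For all sufficiently large $n$, $r(n)\ge 2\log n-\log T(n)-2\log\max(c(n),1)-K$. In particular, if $T(n)=n$ for all large $n$ and $c(n)=O(\log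 n)$, then $r(n)\ge\log n-O(\log\log n)$. (2) For all sufficiently large $n$ with $n^2/T(n)\ge 2$, $c(n)\ge \log (n^2/T(n))-2\log\log (n^2/T(n))-K$. In particular, if $T(n)=O(n)$, then $c(n)\ge\log n-2\log\log n-O(1)$. (3) For all sufficiently large $n$, $T(n)\ge a\,n/(c(n)+1)$. Here "sufficiently large" and the $O$-constants in the two special cases may depend on the algorithm. -/

import Mathlib

open Filter Asymptotics

namespace ShortPrograms

/-- Machines are partial recursive functions on binary strings. A machine `U` is *standard* if it
simulates every machine `V` through a polynomial-time computable translation `t` of programs which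
lengthens programs by at most an additive constant (that may depend on `V`). -/
def IsStandard (U : List Bool →. List Bool) : Prop :=
  Partrec U ∧
    ∀ V : List Bool →. List Bool, Partrec V →
      ∃ t : List Bool → List Bool,
        Nonempty (Turing.TM2ComputableInPolyTime
          (id : List Bool → List Bool) (id : List Bool → List Bool) t) ∧
        (∀ p, U (t p) = V p) ∧
        ∃ k : ℕ, ∀ p, (t p).length ≤ p.length + k

/-- Plain Kolmogorov complexity relative to `U`: the least length of a program for `x`. -/
noncomputable def complexity (U : List Bool →. List Bool) (x : List Bool) : ℕ :=
  sInf {m : ℕ | ∃ p : List Bool, x ∈ U p ∧ p.length = m}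

/-- `p` is a `c`-short program for `x` relative to `U`. -/
def IsShortProgram (U : List Bool →. List Bool) (c : ℕ) (x p : List Bool) : Prop :=
  x ∈ U p ∧ p.length ≤ complexity U x + c

/-- `F` is a probabilistic algorithm that list-approximates short programs, with list size `T`,
number of random bits `r` and closeness `c`, all three being functions of the length of the input.
On input `x` and random string `ρ` the output is a finite set of strings, presented by a
list `L` (order and repetitions are irrelevant). The number of random bits to be read and the
closeness are computable from the input length. -/
structure ListApproximates (U : List Bool →. List Bool)
    (F : List Bool × List Bool →. List (List Bool)) (T r c : ℕ → ℕ) : Prop where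
  partrec : Partrec F
  computable_r : Computable r
  computable_c : Computable c
  /-- On every input and every random string of the right length, `F` halts and outputs a set
  of exactly `T` strings. -/
  halts : ∀ x ρ : List Bool, ρ.length = r x.length →
    ∃ L ∈ F (x, ρ), L.toFinset.card = T x.length
  /-- For every `x`, at least half of the `2 ^ r` sets contain a `c`-short program for `x`. -/
  half : ∀ x : List Bool,
    2 ^ r x.length ≤
      2 * {ρ : List Bool | ρ.length = r x.length ∧
        ∃ L ∈ F (x, ρ), ∃ p ∈ L, IsShortProgram U (c x.length) x p}.ncard

end ShortPrograms

namespace ShortPrograms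

open Nat.Partrec (Code)

/-! The proof plays a counting game against the algorithm. A universal "keeper" machine accepts
requests `(s, S)` from every code `e`, asking that the programs of length `s` print the strings of
`S`. It serves each code at most once, uses each length at most once, and requires `2 ^ e ≤ s`.
Below `N` only about `log N` codes compete, so a code requesting many more lengths than that is
eventually served. Hence (`exists_overhead`) a standard `U` has a constant `k`, fixed before the
requests are, such that some requested `S` has all its strings of complexity at most `s + k`.

The requests are traps. With `h = k + c n`, a `Trap` consists of `2 ^ s` strings of length `n` and a
set `R` of at most `2 ^ (s - 3)` candidate programs such that, for each `x ∈ S`, fewer than a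
quarter of the lists contain a heavy candidate of suitable length outside `R`. If all of `S` had
complexity at most `s + k`, counting would give an `x ∈ S` with no program in `R`, none shorter than
`s - 3`, and few of length at most `s + h`. Its light programs would cover at most a quarter of the
lists and its heavy ones less than a quarter, contradicting success probability one half
(`exists_complex_of_trap`).

If either inequality of `exists_bounds` fails at `n`, traps exist for about `n / 8` lengths `s`.
When `T` is small, averaging over `s` allows `R` to be empty. Otherwise each `x` typically has few
heavy candidates, and a greedily chosen `R` swallows those of enough `x`
(`exists_subset_capturing`). Failure for infinitely many `n` makes the set of traps rich, which is
impossible. Parts (1) and (2) come from the two arguments of the minimum in the first inequality,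
part (3) from the second. -/

/-! ### Binary strings -/

/-- All binary strings of length `n`. -/
def strings : ℕ → List (List Bool)
  | 0 => [[]]
  | n + 1 => (strings n).flatMap fun l => [false :: l, true :: l]

theorem mem_strings {n : ℕ} {l : List Bool} : l ∈ strings n ↔ l.length = n := by
  induction n generalizing l with
  | zero => simp [strings]
  | succ n ih =>
    cases l with
    | nil => simp [strings]
    | cons b l => cases b <;> simp [strings, ih]

theorem length_strings (n : ℕ) : (strings n).length = 2 ^ n := by
  induction n with
  | zero => rfl
  | succ n ih => simp [strings, List.length_flatMap, ih, pow_succ]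

theorem nodup_strings (n : ℕ) : (strings n).Nodup := by
  induction n with
  | zero => simp [strings]
  | succ n ih =>
    rw [strings, List.nodup_flatMap]
    refine ⟨fun x _ => by simp, ih.imp fun {a b} hab => ?_⟩
    simp [Function.onFun, hab.symm]

theorem primrec_strings : Primrec strings := by
  have h : Primrec (Nat.rec [[]] fun _ L => L.flatMap fun l => [false :: l, true :: l] :
      ℕ → List (List Bool)) := by
    refine Primrec.nat_rec₁ _ (Primrec.list_flatMap Primrec.snd ?_)
    exact Primrec.list_cons.comp (Primrec.list_cons.comp (Primrec.const false) Primrec.snd)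
      (Primrec.list_cons.comp (Primrec.list_cons.comp (Primrec.const true) Primrec.snd)
        (Primrec.const []))
  refine h.of_eq fun n => ?_
  induction n with
  | zero => rfl
  | succ n ih => simp only [strings, ← ih]

theorem primrec_pow : Primrec₂ fun a b : ℕ => a ^ b :=
  Primrec₂.unpaired'.1 Nat.Primrec.pow

theorem primrec_idxOf : Primrec₂ fun (l : List Bool) (L : List (List Bool)) => L.idxOf l := by
  convert! Primrec.list_idxOf (α := List Bool) using 1
  funext l L
  congr 1
  exact lawful_beq_subsingleton _ _

/-! ### Granting commitments, and the overhead of a standard machine -/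

/-- A commitment `(e, s, S)`: the programs of length `s` are to produce the strings in `S`, as
requested by the machine with code `e`. -/
abbrev Commitment := ℕ × ℕ × List (List Bool)

/-- A machine requests `(s, S)` by halting on the code of this pair. -/
def request (t : ℕ) : Option Commitment :=
  (Code.evaln t.unpair.2.unpair.1 (Denumerable.ofNat Code t.unpair.1) t.unpair.2.unpair.2).bind
    fun _ => (Encodable.decode t.unpair.2.unpair.2 : Option (ℕ × List (List Bool))).map
      fun a => (t.unpair.1, a)

/-- `a` may be granted when `L` has been granted. -/
def Grantable (L : List Commitment) (a : Commitment) : Prop :=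
  -- The first condition leaves only codes `e ≤ log N` as competitors for lengths up to `N`.
  2 ^ a.1 ≤ a.2.1 ∧ ∀ b ∈ L, b.1 ≠ a.1 ∧ b.2.1 ≠ a.2.1

instance (L : List Commitment) (a : Commitment) : Decidable (Grantable L a) :=
  inferInstanceAs (Decidable (_ ∧ _))

/-- The commitments granted before stage `t`. -/
def commitments : ℕ → List Commitment
  | 0 => []
  | t + 1 => (request t).elim (commitments t) fun a =>
      if Grantable (commitments t) a then commitments t ++ [a] else commitments t

theorem primrec_request : Primrec request := by
  have h1 : Primrec fun t : ℕ => t.unpair.1 := Primrec.fst.comp Primrec.unpair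
  have h2 : Primrec fun t : ℕ => t.unpair.2.unpair.1 :=
    Primrec.fst.comp (Primrec.unpair.comp (Primrec.snd.comp Primrec.unpair))
  have h3 : Primrec fun t : ℕ => t.unpair.2.unpair.2 :=
    Primrec.snd.comp (Primrec.unpair.comp (Primrec.snd.comp Primrec.unpair))
  refine Primrec.option_bind
    (Code.primrec_evaln.comp ((h2.pair ((Primrec.ofNat Code).comp h1)).pair h3)) ?_
  refine Primrec.option_map (Primrec.decode.comp (h3.comp Primrec.fst)) ?_
  exact Primrec.pair (h1.comp (Primrec.fst.comp Primrec.fst)) Primrec.snd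

theorem primrecRel_grantable : PrimrecRel Grantable := by
  refine PrimrecPred.and (Primrec.nat_le.comp
    (primrec_pow.comp (Primrec.const 2) (Primrec.fst.comp Primrec.snd))
    (Primrec.fst.comp (Primrec.snd.comp Primrec.snd))) ?_
  refine PrimrecRel.forall_mem_list (R := fun b a : Commitment => b.1 ≠ a.1 ∧ b.2.1 ≠ a.2.1) ?_
  exact PrimrecPred.and
    (PrimrecPred.not (Primrec.eq.comp (Primrec.fst.comp Primrec.fst)
      (Primrec.fst.comp Primrec.snd)))
    (PrimrecPred.not (Primrec.eq.comp (Primrec.fst.comp (Primrec.snd.comp Primrec.fst))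
      (Primrec.fst.comp (Primrec.snd.comp Primrec.snd))))

theorem primrec_commitments : Primrec commitments := by
  have h : Primrec (Nat.rec [] fun t L => (request t).elim L fun a =>
      if Grantable L a then L ++ [a] else L : ℕ → List Commitment) := by
    refine Primrec.nat_rec₁ _ ?_
    have : Primrec₂ fun (t : ℕ) (L : List Commitment) =>
        (Option.casesOn (request t) L fun a => if Grantable L a then L ++ [a] else L :
          List Commitment) := by
      refine Primrec.option_casesOn (primrec_request.comp Primrec.fst) Primrec.snd ?_
      have hL : Primrec fun q : (ℕ × List Commitment) × Commitment => q.1.2 :=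
        Primrec.snd.comp Primrec.fst
      exact Primrec.ite (primrecRel_grantable.comp hL Primrec.snd)
        (Primrec.list_concat.comp hL Primrec.snd) hL
    refine this.of_eq fun t L => ?_
    cases request t <;> rfl
  refine h.of_eq fun n => ?_
  induction n with
  | zero => rfl
  | succ n ih => simp only [commitments, ← ih]

theorem commitments_prefix {t t' : ℕ} (h : t ≤ t') : commitments t <+: commitments t' := by
  induction t', h using Nat.le_induction with
  | base => exact List.prefix_refl _
  | succ t' _ ih =>
    refine ih.trans ?_
    rw [commitments]
    cases request t' with
    | none => exact List.prefix_refl _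
    | some a =>
      simp only [Option.elim]
      split_ifs
      · exact List.prefix_append _ _
      · exact List.prefix_refl _

theorem commitments_pairwise (t : ℕ) :
    (commitments t).Pairwise fun a b => a.1 ≠ b.1 ∧ a.2.1 ≠ b.2.1 := by
  induction t with
  | zero => simp [commitments]
  | succ t ih =>
    rw [commitments]
    cases request t with
    | none => exact ih
    | some a =>
      simp only [Option.elim]
      split_ifs with h
      · rw [List.pairwise_append]
        refine ⟨ih, by simp, fun b hb c hc => ?_⟩
        rw [List.mem_singleton.1 hc]
        exact h.2 b hb
      · exact ih

theorem commitments_spec {t : ℕ} {a : Commitment} (ha : a ∈ commitments t) :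
    2 ^ a.1 ≤ a.2.1 ∧ ∃ t', request t' = some a := by
  induction t with
  | zero => simp [commitments] at ha
  | succ t ih =>
    rw [commitments] at ha
    rcases hr : request t with _ | b
    · rw [hr] at ha; exact ih ha
    · rw [hr] at ha
      simp only [Option.elim] at ha
      split_ifs at ha with h
      · rcases List.mem_append.1 ha with h' | h'
        · exact ih h'
        · rw [List.mem_singleton.1 h']
          exact ⟨h.1, t, hr⟩
      · exact ih ha

theorem request_spec {t : ℕ} {a : Commitment} (h : request t = some a) :
    ∃ m, Encodable.decode m = some a.2 ∧ (Code.eval (Denumerable.ofNat Code a.1) m).Dom := by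
  simp only [request, Option.bind_eq_some_iff, Option.map_eq_some_iff] at h
  obtain ⟨v, hv, b, hb, rfl⟩ := h
  exact ⟨_, hb, Part.dom_iff_mem.2 ⟨v, Code.evaln_sound hv⟩⟩

theorem exists_request {e : ℕ} {b : ℕ × List (List Bool)}
    (h : (Code.eval (Denumerable.ofNat Code e) (Encodable.encode b)).Dom) :
    ∃ t, request t = some (e, b) := by
  obtain ⟨v, hv⟩ := Part.dom_iff_mem.1 h
  obtain ⟨k, hk⟩ := Code.evaln_complete.1 hv
  refine ⟨Nat.pair e (Nat.pair k (Encodable.encode b)), ?_⟩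
  simp only [request, Nat.unpair_pair, Encodable.encodek, Option.map_some]
  rw [Option.mem_def.1 hk]
  rfl

/-- The output promised to the program `p` before stage `t`. -/
def promise (p : List Bool) (t : ℕ) : Option (List Bool) :=
  ((commitments t).filter fun a => a.2.1 = p.length).head?.map
    -- The `i`-th string of length `s` is to print the `i`-th element of `S`; programs beyond the
    -- end of `S` get the irrelevant value `[]`.
    fun a => a.2.2.getD ((strings p.length).idxOf p) []

/-- Commitments are only appended, so the first one of a given length never changes. This makes the
unbounded search in `keeper` independent of the stage. -/
theorem promise_mono {p x : List Bool} {t t' : ℕ} (h : t ≤ t') (hx : x ∈ promise p t) :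
    x ∈ promise p t' := by
  obtain ⟨L, hL⟩ := commitments_prefix h
  rw [promise, ← hL, List.filter_append]
  unfold promise at hx
  cases hf : (commitments t).filter fun a => a.2.1 = p.length with
  | nil => rw [hf] at hx; simp at hx
  | cons a l => rw [hf] at hx; simpa using hx

theorem computable_promise : Computable₂ promise := by
  have h1 : Primrec₂ fun (L : List Commitment) (n : ℕ) => L.filter fun a => a.2.1 = n := by
    refine PrimrecRel.listFilter (R := fun (a : Commitment) (n : ℕ) => a.2.1 = n) ?_
    exact Primrec.eq.comp (Primrec.fst.comp (Primrec.snd.comp Primrec.fst)) Primrec.snd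
  have h2 : Primrec₂ promise := by
    refine Primrec.option_map (Primrec.list_head?.comp (h1.comp
      (primrec_commitments.comp Primrec.snd) (Primrec.list_length.comp Primrec.fst))) ?_
    have hp : Primrec fun q : (List Bool × ℕ) × Commitment => q.1.1 :=
      Primrec.fst.comp Primrec.fst
    exact (Primrec.list_getD []).comp (Primrec.snd.comp (Primrec.snd.comp Primrec.snd))
      (primrec_idxOf.comp hp (primrec_strings.comp (Primrec.list_length.comp hp)))
  exact h2.to_comp

/-- The machine that keeps all promises. -/
def keeper (p : List Bool) : Part (List Bool) := Nat.rfindOpt (promise p)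

theorem partrec_keeper : Partrec keeper := Partrec.rfindOpt computable_promise

theorem exists_mem_keeper {t : ℕ} {a : Commitment} (ha : a ∈ commitments t)
    (hl : a.2.2.length ≤ 2 ^ a.2.1) {x : List Bool} (hx : x ∈ a.2.2) :
    ∃ p : List Bool, p.length = a.2.1 ∧ x ∈ keeper p := by
  obtain ⟨i, hi, rfl⟩ := List.mem_iff_getElem.1 hx
  have hi' : i < (strings a.2.1).length := by rw [length_strings]; omega
  have hp : ((strings a.2.1)[i]).length = a.2.1 := mem_strings.1 (List.getElem_mem hi')
  refine ⟨(strings a.2.1)[i], hp, (Nat.rfindOpt_mono fun h => promise_mono h).2 ⟨t, ?_⟩⟩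
  have hfilter : ((commitments t).filter fun b => b.2.1 = a.2.1) = [a] := by
    have hmem : a ∈ (commitments t).filter fun b => b.2.1 = a.2.1 := by simp [ha]
    have hpw := (commitments_pairwise t).filter fun b => b.2.1 = a.2.1
    have hall : ∀ b ∈ (commitments t).filter fun b => b.2.1 = a.2.1, b.2.1 = a.2.1 := by simp
    generalize (commitments t).filter (fun b => b.2.1 = a.2.1) = L at *
    match L with
    | [] => simp at hmem
    | [b] => rw [List.mem_singleton.1 hmem]
    | b :: c :: L =>
      have := (List.pairwise_cons.1 hpw).1 c (by simp)
      exact absurd ((hall b (by simp)).trans (hall c (by simp)).symm) this.2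
  rw [promise, hp, hfilter, (nodup_strings _).idxOf_getElem]
  simp only [List.head?_cons, Option.map_some, List.getD_eq_getElem _ _ hi, Option.mem_def]

/-- For a standard machine there is an overhead `k` such that every enumerable set of pairs
`(s, S)`, rich enough in its first components, has an element such that all strings in `S` have
programs of length at most `s + k`. -/
theorem exists_overhead {U : List Bool →. List Bool} (hU : IsStandard U) :
    ∃ k : ℕ, ∀ Q : ℕ × List (List Bool) → Prop, REPred Q →
      (∀ m : ℕ, ∃ (N : ℕ) (A : Finset ℕ), (∀ s ∈ A, s ≤ N ∧ ∃ S, Q (s, S)) ∧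
        Nat.log 2 N + m < A.card) →
      ∃ s S, Q (s, S) ∧ (S.length ≤ 2 ^ s → ∀ x ∈ S, ∃ p, x ∈ U p ∧ p.length ≤ s + k) := by
  obtain ⟨tr, -, htr, k, hk⟩ := hU.2 keeper partrec_keeper
  refine ⟨k, fun Q hQ hrich => ?_⟩
  obtain ⟨c, hc⟩ := Code.exists_code.1 hQ
  have hdom : ∀ b, (Code.eval c (Encodable.encode b)).Dom ↔ Q b := by
    intro b
    rw [hc]
    simp [Part.assert]
  have hdom' : ∀ m b, Encodable.decode m = some b → (Code.eval c m).Dom → Q b := by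
    intro m b hm h
    rw [hc] at h
    simpa [hm, Part.assert] using h
  set e := Encodable.encode c with he
  have hce : Denumerable.ofNat Code e = c := Denumerable.ofNat_encode c
  suffices h : ∃ t, ∃ a ∈ commitments t, a.1 = e by
    obtain ⟨t, a, ha, hae⟩ := h
    obtain ⟨-, t', ht'⟩ := commitments_spec ha
    obtain ⟨m, hm, hm'⟩ := request_spec ht'
    rw [hae, hce] at hm'
    refine ⟨a.2.1, a.2.2, hdom' m _ hm hm', fun hl x hx => ?_⟩
    obtain ⟨p, hp, hxp⟩ := exists_mem_keeper ha hl hx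
    exact ⟨tr p, by rw [htr]; exact hxp, by rw [← hp]; exact hk p⟩
  by_contra! hno
  -- Never served, `e` finds every requested length from `2 ^ e` on taken by another code. There are
  -- at most `2 ^ e` smaller lengths and `Nat.log 2 N + 1` competing codes, each holding one length.
  obtain ⟨N, A, hA, hcard⟩ := hrich (2 ^ e + 1)
  have hused : ∀ s ∈ A, 2 ^ e ≤ s → ∃ t, ∃ a ∈ commitments t, a.2.1 = s := by
    intro s hs hes
    obtain ⟨S, hS⟩ := (hA s hs).2
    obtain ⟨t, ht⟩ := exists_request (e := e) (b := (s, S)) (by rw [hce]; exact (hdom _).2 hS)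
    have hng : ¬ Grantable (commitments t) (e, s, S) := by
      intro hg
      refine hno (t + 1) (e, s, S) ?_ rfl
      simp [commitments, ht, hg]
    simp only [Grantable, not_and, not_forall] at hng
    -- The refusal cannot be due to an earlier grant to `e`, so the length `s` is already taken.
    obtain ⟨b, hb, hb'⟩ := hng hes
    exact ⟨t, b, hb, by_contra fun h => hb' (hno t b hb) h⟩
  have hchoose : ∀ s, ∃ e' t, s ∈ A.filter (2 ^ e ≤ ·) → ∃ a ∈ commitments t, a.2.1 = s ∧ a.1 = e' := by
    intro s
    by_cases hs : s ∈ A.filter (2 ^ e ≤ ·)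
    · obtain ⟨t, a, ha, has⟩ := hused s (Finset.mem_filter.1 hs).1 (Finset.mem_filter.1 hs).2
      exact ⟨a.1, t, fun _ => ⟨a, ha, has, rfl⟩⟩
    · exact ⟨0, 0, fun h => absurd h hs⟩
  choose f g hfg using hchoose
  have hinj : Set.InjOn f (A.filter (2 ^ e ≤ ·)) := by
    intro s hs s' hs' hss
    obtain ⟨a, ha, has, hae⟩ := hfg s hs
    obtain ⟨b, hb, hbs, hbe⟩ := hfg s' hs'
    have ha' := (commitments_prefix (le_max_left (g s) (g s'))).subset ha
    have hb' := (commitments_prefix (le_max_right (g s) (g s'))).subset hb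
    by_contra hne
    have hab : a ≠ b := by rintro rfl; exact hne (has.symm.trans hbs)
    have : Std.Symm fun a b : Commitment => a.1 ≠ b.1 ∧ a.2.1 ≠ b.2.1 :=
      ⟨fun _ _ h => ⟨h.1.symm, h.2.symm⟩⟩
    have := (commitments_pairwise (max (g s) (g s'))).forall ha' hb' hab
    exact this.1 (hae.trans (hss.trans hbe.symm))
  have hmaps : ∀ s ∈ A.filter (2 ^ e ≤ ·), f s ∈ Finset.range (Nat.log 2 N + 1) := by
    intro s hs
    obtain ⟨a, ha, has, hae⟩ := hfg s hs
    have h1 := (commitments_spec ha).1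
    have h2 := (hA s (Finset.mem_filter.1 hs).1).1
    rw [Finset.mem_range, Nat.lt_succ_iff, ← hae]
    exact Nat.le_log_of_pow_le (by norm_num) (by omega)
  have h1 := Finset.card_le_card_of_injOn f hmaps hinj
  have h2 : (A.filter fun s => ¬ 2 ^ e ≤ s).card ≤ (Finset.range (2 ^ e)).card :=
    Finset.card_le_card fun s hs => by
      simp only [Finset.mem_filter, Finset.mem_range] at hs ⊢; omega
  have h3 := Finset.card_filter_add_card_filter_not (s := A) (2 ^ e ≤ ·)
  simp only [Finset.card_range] at h1 h2
  omega

/-! ### Traps and their enumerability -/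

theorem computable_list_map {α β : Type*} [Primcodable α] [Primcodable β] {G : α → β}
    (hG : Computable G) : Computable fun L : List α => L.map G := by
  have h : Computable fun L : List α => (Nat.rec [] (fun i acc =>
      acc ++ (L[i]?.map G).toList) L.length : List β) := by
    refine Computable.nat_rec (h := fun (L : List α) (q : ℕ × List β) =>
      q.2 ++ (L[q.1]?.map G).toList) Computable.list_length (Computable.const []) ?_
    refine Computable.list_append.comp (Computable.snd.comp Computable.snd) ?_
    refine Primrec.optionToList.to_comp.comp (Computable.option_map
      (Computable.list_getElem?.comp Computable.fst (Computable.fst.comp Computable.snd)) ?_)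
    exact hG.comp Computable.snd
  refine h.of_eq fun L => ?_
  have key : ∀ i, (Nat.rec [] (fun i acc => acc ++ (L[i]?.map G).toList) i : List β) =
      (L.take i).map G := by
    intro i
    induction i with
    | zero => simp
    | succ i ih => 
      rw [List.take_add_one, List.map_append, ← ih]
      rcases h : L[i]? with _ | a <;> simp [h]
  rw [key, List.take_length]

theorem rePred_exists {α β : Type*} [Primcodable α] [Primcodable β] {p : α × β → Prop}
    (hp : ComputablePred p) : REPred fun a => ∃ b, p (a, b) := by
  obtain ⟨f, hf, rfl⟩ := ComputablePred.computable_iff.1 hp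
  have h : Computable₂ fun (a : α) (n : ℕ) => (Encodable.decode n : Option β).bind
      fun b => cond (f (a, b)) (some ()) none := by
    refine Computable.option_bind (Computable.decode.comp Computable.snd) ?_
    exact Computable.cond (hf.comp ((Computable.fst.comp Computable.fst).pair Computable.snd))
      (Computable.const _) (Computable.const _)
  refine (Partrec.rfindOpt h).dom_re.of_eq fun a => ?_
  rw [Nat.rfindOpt_dom]
  constructor
  · rintro ⟨n, u, hu⟩
    obtain ⟨b, -, hb⟩ := Option.bind_eq_some_iff.1 hu
    refine ⟨b, ?_⟩
    cases hfb : f (a, b) <;> simp_all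
  · rintro ⟨b, hb⟩
    exact ⟨Encodable.encode b, (), by simp [hb]⟩

/-- `p` is in at least a fraction `2 ^ (-b)` of the lists in `Y`. -/
def Heavy (b : ℕ) (Y : List (List (List Bool))) (p : List Bool) : Prop :=
  Y.length ≤ 2 ^ b * (Y.filter fun l => p ∈ l).length

instance (b : ℕ) (Y : List (List (List Bool))) (p : List Bool) : Decidable (Heavy b Y p) :=
  inferInstanceAs (Decidable (_ ≤ _))

/-- `p` is a heavy string in `Y`, not in `R`, and of length between `s - 3` and `s + h`. -/
def Relevant (s h : ℕ) (R : List (List Bool)) (Y : List (List (List Bool)))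
    (p : List Bool) : Prop :=
  -- The exponent `h + 5` is matched to the at most `2 ^ (h + 3)` short programs of a typical
  -- string: together the light ones cover at most a quarter of the lists.
  s ≤ p.length + 3 ∧ p.length ≤ s + h ∧ p ∉ R ∧ Heavy (h + 5) Y p

instance (s h : ℕ) (R : List (List Bool)) (Y : List (List (List Bool))) (p : List Bool) :
    Decidable (Relevant s h R Y p) :=
  inferInstanceAs (Decidable (_ ∧ _))

/-- The lists in `Y` that have a relevant member. -/
def hits (s h : ℕ) (R : List (List Bool)) (Y : List (List (List Bool))) :
    List (List (List Bool)) :=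
  Y.filter fun l => ∃ p ∈ l, Relevant s h R Y p

/-- `S` consists of `2 ^ s` strings of length `n`, and the set `R` of size at most `2 ^ (s - 3)`
contains almost all candidate programs of length about `s` for strings in `S`. -/
def Trap (G : List Bool → List (List (List Bool))) (h n s : ℕ) (S R : List (List Bool)) : Prop :=
  S.length = 2 ^ s ∧ S.Nodup ∧ (∀ x ∈ S, x.length = n) ∧ 8 * R.length ≤ 2 ^ s ∧
    ∀ x ∈ S, 4 * (hits s h R (G x)).length < (G x).length

theorem primrecRel_mem : PrimrecRel fun (l : List (List Bool)) (p : List Bool) => p ∈ l := by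
  have h : PrimrecRel fun (l : List (List Bool)) (p : List Bool) => ∃ a ∈ l, a = p :=
    PrimrecRel.exists_mem_list Primrec.eq
  exact h.of_eq fun l p => by simp

theorem primrecPred_heavy : PrimrecPred fun q : (ℕ × List (List (List Bool))) × List Bool =>
    Heavy q.1.1 q.1.2 q.2 := by
  have hf : Primrec₂ fun (Y : List (List (List Bool))) (p : List Bool) =>
      Y.filter fun l => p ∈ l := primrecRel_mem.listFilter
  have hY : Primrec fun q : (ℕ × List (List (List Bool))) × List Bool => q.1.2 :=
    Primrec.snd.comp Primrec.fst
  exact Primrec.nat_le.comp (Primrec.list_length.comp hY) (Primrec.nat_mul.comp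
    (primrec_pow.comp (Primrec.const 2) (Primrec.fst.comp Primrec.fst))
    (Primrec.list_length.comp (hf.comp hY Primrec.snd)))

theorem primrecRel_relevant : PrimrecRel fun (p : List Bool)
    (q : ((ℕ × ℕ) × List (List Bool)) × List (List (List Bool))) =>
      Relevant q.1.1.1 q.1.1.2 q.1.2 q.2 p := by
  have hl : Primrec fun q : List Bool × (((ℕ × ℕ) × List (List Bool)) ×
      List (List (List Bool))) => q.1.length := Primrec.list_length.comp Primrec.fst
  have h1 : Primrec fun q : List Bool × (((ℕ × ℕ) × List (List Bool)) ×
      List (List (List Bool))) => q.2.1 := Primrec.fst.comp Primrec.snd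
  have hs : Primrec fun q : List Bool × (((ℕ × ℕ) × List (List Bool)) ×
      List (List (List Bool))) => q.2.1.1.1 := Primrec.fst.comp (Primrec.fst.comp h1)
  have hh : Primrec fun q : List Bool × (((ℕ × ℕ) × List (List Bool)) ×
      List (List (List Bool))) => q.2.1.1.2 := Primrec.snd.comp (Primrec.fst.comp h1)
  refine PrimrecPred.and (Primrec.nat_le.comp hs (Primrec.nat_add.comp hl (Primrec.const 3))) ?_
  refine PrimrecPred.and (Primrec.nat_le.comp hl (Primrec.nat_add.comp hs hh)) ?_
  refine PrimrecPred.and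
    (PrimrecPred.not (primrecRel_mem.comp (Primrec.snd.comp h1) Primrec.fst)) ?_
  exact primrecPred_heavy.comp (((Primrec.nat_add.comp hh (Primrec.const 5)).pair
    (Primrec.snd.comp Primrec.snd)).pair Primrec.fst)

theorem primrec_hits : Primrec fun q : ((ℕ × ℕ) × List (List Bool)) × List (List (List Bool)) =>
    hits q.1.1.1 q.1.1.2 q.1.2 q.2 := by
  have h := (PrimrecRel.exists_mem_list primrecRel_relevant).listFilter
  exact h.comp Primrec.snd Primrec.id

/-- This bounded-quantifier form shows that the property is primitive recursive. -/
theorem nodup_iff_idxOf {α : Type*} [BEq α] [LawfulBEq α] (L : List α) (d : α) :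
    L.Nodup ↔ ∀ i ∈ List.range L.length, L.idxOf (L.getD i d) = i := by
  simp only [List.mem_range]
  constructor
  · intro h i hi
    rw [List.getD_eq_getElem _ _ hi, h.idxOf_getElem]
  · intro h
    rw [List.nodup_iff_injective_get]
    intro i j hij
    have hi := h i i.2
    have hj := h j j.2
    rw [List.getD_eq_getElem _ _ i.2] at hi
    rw [List.getD_eq_getElem _ _ j.2] at hj
    simp only [List.get_eq_getElem] at hij
    rw [hij, hj] at hi
    exact Fin.ext hi.symm

theorem primrecPred_nodup : PrimrecPred fun L : List (List Bool) => L.Nodup := by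
  have h : PrimrecRel fun (i : ℕ) (L : List (List Bool)) => L.idxOf (L.getD i []) = i :=
    Primrec.eq.comp (primrec_idxOf.comp
      ((Primrec.list_getD []).comp Primrec.snd Primrec.fst) Primrec.snd) Primrec.fst
  refine (h.forall_mem_list.comp (Primrec.list_range.comp Primrec.list_length)
    Primrec.id).of_eq fun L => (nodup_iff_idxOf L []).symm

/-- A witness contains `n`, `R`, and also the values of `h` and `G` that occur. Checking these
values is computable, and given them the remaining conditions are primitive recursive. -/
theorem rePred_trap {G : List Bool → List (List (List Bool))} {h : ℕ → ℕ} (hG : Computable G)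
    (hh : Computable h) :
    REPred fun a : ℕ × List (List Bool) => ∃ n R, Trap G (h n) n a.1 a.2 R := by
  let W := (ℕ × ℕ) × List (List Bool) × List (List (List (List Bool)))
  have h1 : ComputablePred fun q : (ℕ × List (List Bool)) × W =>
      (h q.2.1.1 = q.2.1.2 ∧ q.1.2.map G = q.2.2.2) := by
    have e1 : Computable fun q : (ℕ × List (List Bool)) × W =>
        decide (h q.2.1.1 = q.2.1.2) :=
      Primrec.eq.decide.to_comp.comp (hh.comp (Computable.fst.comp (Computable.fst.comp
        Computable.snd))) (Computable.snd.comp (Computable.fst.comp Computable.snd))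
    have e2 : Computable fun q : (ℕ × List (List Bool)) × W =>
        decide (q.1.2.map G = q.2.2.2) :=
      Primrec.eq.decide.to_comp.comp ((computable_list_map hG).comp
        (Computable.snd.comp Computable.fst))
        (Computable.snd.comp (Computable.snd.comp Computable.snd))
    exact Computable.computablePred
      ((Primrec.and.to_comp.comp e1 e2).of_eq fun q => by simp)
  have h2 : PrimrecPred fun q : (ℕ × List (List Bool)) × W =>
      (q.1.2.length = 2 ^ q.1.1 ∧ q.1.2.Nodup ∧ (∀ x ∈ q.1.2, x.length = q.2.1.1) ∧
        8 * q.2.2.1.length ≤ 2 ^ q.1.1 ∧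
        ∀ Y ∈ q.2.2.2, 4 * (hits q.1.1 q.2.1.2 q.2.2.1 Y).length < Y.length) := by
    have hs : Primrec fun q : (ℕ × List (List Bool)) × W => q.1.1 :=
      Primrec.fst.comp Primrec.fst
    have hS : Primrec fun q : (ℕ × List (List Bool)) × W => q.1.2 :=
      Primrec.snd.comp Primrec.fst
    have hn : Primrec fun q : (ℕ × List (List Bool)) × W => q.2.1.1 :=
      Primrec.fst.comp (Primrec.fst.comp Primrec.snd)
    have hc : Primrec fun q : (ℕ × List (List Bool)) × W => q.2.1.2 :=
      Primrec.snd.comp (Primrec.fst.comp Primrec.snd)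
    have hR : Primrec fun q : (ℕ × List (List Bool)) × W => q.2.2.1 :=
      Primrec.fst.comp (Primrec.snd.comp Primrec.snd)
    have hY : Primrec fun q : (ℕ × List (List Bool)) × W => q.2.2.2 :=
      Primrec.snd.comp (Primrec.snd.comp Primrec.snd)
    have h2s := primrec_pow.comp (Primrec.const 2) hs
    refine (Primrec.eq.comp (Primrec.list_length.comp hS) h2s).and
      ((primrecPred_nodup.comp hS).and (PrimrecPred.and ?_ (PrimrecPred.and
      (Primrec.nat_le.comp (Primrec.nat_mul.comp (Primrec.const 8)
        (Primrec.list_length.comp hR)) h2s) ?_)))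
    · have : PrimrecRel fun (x : List Bool) (n : ℕ) => x.length = n :=
        Primrec.eq.comp (Primrec.list_length.comp Primrec.fst) Primrec.snd
      exact this.forall_mem_list.comp hS hn
    · have : PrimrecRel fun (Y : List (List (List Bool))) (q : (ℕ × ℕ) × List (List Bool)) =>
          4 * (hits q.1.1 q.1.2 q.2 Y).length < Y.length :=
        Primrec.nat_lt.comp (Primrec.nat_mul.comp (Primrec.const 4) (Primrec.list_length.comp
          (primrec_hits.comp (Primrec.snd.pair Primrec.fst))))
          (Primrec.list_length.comp Primrec.fst)
      exact this.forall_mem_list.comp hY ((hs.pair hc).pair hR)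
  have h3 : ComputablePred fun q : (ℕ × List (List Bool)) × W =>
      ((h q.2.1.1 = q.2.1.2 ∧ q.1.2.map G = q.2.2.2) ∧
      (q.1.2.length = 2 ^ q.1.1 ∧ q.1.2.Nodup ∧ (∀ x ∈ q.1.2, x.length = q.2.1.1) ∧
        8 * q.2.2.1.length ≤ 2 ^ q.1.1 ∧
        ∀ Y ∈ q.2.2.2, 4 * (hits q.1.1 q.2.1.2 q.2.2.1 Y).length < Y.length)) := by
    classical
    exact Computable.computablePred ((Primrec.and.to_comp.comp h1.decide
      h2.computablePred.decide).of_eq fun q => by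
        rw [Bool.eq_iff_iff]
        simp only [Bool.and_eq_true, decide_eq_true_eq])
  refine (rePred_exists h3).of_eq fun a => ?_
  constructor
  · rintro ⟨⟨⟨n, c⟩, R, Ys⟩, ⟨hc, hY⟩, h4, h5, h6, h7, h8⟩
    dsimp only at *
    refine ⟨n, R, h4, h5, h6, h7, fun x hx => ?_⟩
    rw [hc]
    exact h8 _ (hY ▸ List.mem_map_of_mem hx)
  · rintro ⟨n, R, h4, h5, h6, h7, h8⟩
    refine ⟨((n, h n), R, a.2.map G), ⟨rfl, rfl⟩, h4, h5, h6, h7, fun Y hY => ?_⟩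
    obtain ⟨x, hx, rfl⟩ := List.mem_map.1 hY
    exact h8 x hx

/-- The lists produced on an input, for all random strings. -/
theorem ListApproximates.exists_outputs {U : List Bool →. List Bool}
    {F : List Bool × List Bool →. List (List Bool)} {T r c : ℕ → ℕ}
    (hF : ListApproximates U F T r c) :
    ∃ f : List Bool → List Bool → List (List Bool),
      (Computable fun x => (strings (r x.length)).map (f x)) ∧
      ∀ x ρ, ρ.length = r x.length → f x ρ ∈ F (x, ρ) := by
  have hr : Computable fun x : List Bool => strings (r x.length) :=
    primrec_strings.to_comp.comp (hF.computable_r.comp Computable.list_length)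
  -- The default `[]` on random strings of the wrong length makes the algorithm total, so it can be
  -- mapped over a list.
  let g : List Bool × List Bool →. List (List Bool) := fun q =>
    cond (decide (q.2.length = r q.1.length)) (F q) (Part.some [])
  have hg : Partrec g := by
    refine Partrec.cond ?_ hF.partrec (Computable.const []).partrec
    exact Primrec.eq.decide.to_comp.comp (Computable.list_length.comp Computable.snd)
      (hF.computable_r.comp (Computable.list_length.comp Computable.fst))
  have hdom : ∀ q, (g q).Dom := by
    intro q
    by_cases hq : q.2.length = r q.1.length
    · obtain ⟨L, hL, -⟩ := hF.halts q.1 q.2 hq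
      simpa [g, hq] using Part.dom_iff_mem.2 ⟨L, hL⟩
    · simp [g, hq]
  have hf : Computable fun q => (g q).get (hdom q) :=
    hg.of_eq_tot fun q => Part.get_mem _
  refine ⟨fun x ρ => (g (x, ρ)).get (hdom (x, ρ)), ?_, fun x ρ hρ => ?_⟩
  · have h1 : Computable fun x : List Bool => (strings (r x.length)).map fun ρ => (x, ρ) := by
      have : Primrec₂ fun (x : List Bool) (L : List (List Bool)) => L.map fun ρ => (x, ρ) :=
        Primrec.list_map Primrec.snd ((Primrec.fst.comp Primrec.fst).pair Primrec.snd)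
      exact this.to_comp.comp Computable.id hr
    refine ((computable_list_map hf).comp h1).of_eq fun x => ?_
    simp
  · have := Part.get_mem (hdom (x, ρ))
    simpa [g, hρ] using this

/-! ### Counting programs, and why traps contain complex strings -/

/-- The finite set of binary strings of length `n`. -/
def cube (n : ℕ) : Finset (List Bool) := (strings n).toFinset

theorem mem_cube {n : ℕ} {l : List Bool} : l ∈ cube n ↔ l.length = n := by
  rw [cube, List.mem_toFinset, mem_strings]

theorem card_cube (n : ℕ) : (cube n).card = 2 ^ n := by
  rw [cube, List.toFinset_card_of_nodup (nodup_strings n), length_strings]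

/-- The finite set of binary strings of length less than `n`. -/
def shortStrings (n : ℕ) : Finset (List Bool) := (Finset.range n).biUnion cube

theorem mem_shortStrings {n : ℕ} {l : List Bool} : l ∈ shortStrings n ↔ l.length < n := by
  simp [shortStrings, mem_cube]

theorem card_shortStrings (n : ℕ) : (shortStrings n).card + 1 = 2 ^ n := by
  rw [shortStrings, Finset.card_biUnion]
  · simp only [card_cube]
    exact Nat.geomSum_eq (le_refl 2) n ▸ by
      have := Nat.one_le_two_pow (n := n)
      omega
  · intro i _ j _ hij
    rw [Function.onFun, Finset.disjoint_left]
    intro l hi hj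
    exact hij ((mem_cube.1 hi).symm.trans (mem_cube.1 hj))

theorem length_filter_map_strings {α : Type*} (n : ℕ) (g : List Bool → α) (P : α → Prop)
    [DecidablePred P] :
    (((strings n).map g).filter fun a => P a).length =
      ((cube n).filter fun ρ => P (g ρ)).card := by
  have h : (cube n).filter (fun ρ => P (g ρ)) =
      ((strings n).filter fun ρ => P (g ρ)).toFinset := by
    rw [List.toFinset_filter, cube]
    simp
  rw [h, List.toFinset_card_of_nodup ((nodup_strings n).filter _), List.filter_map,
    List.length_map]
  rfl

open Classical in
/-- The strings in `X` that have a program in `A`. -/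
noncomputable def produced (U : List Bool →. List Bool) (X A : Finset (List Bool)) :
    Finset (List Bool) :=
  X.filter fun x => ∃ p ∈ A, x ∈ U p

open Classical in
/-- The programs for `x` in `A`. -/
noncomputable def programs (U : List Bool →. List Bool) (A : Finset (List Bool))
    (x : List Bool) : Finset (List Bool) :=
  A.filter fun p => x ∈ U p

open Classical in
theorem mem_produced {U : List Bool →. List Bool} {X A : Finset (List Bool)} {x : List Bool} :
    x ∈ produced U X A ↔ x ∈ X ∧ ∃ p ∈ A, x ∈ U p :=
  Finset.mem_filter

open Classical in
theorem mem_programs {U : List Bool →. List Bool} {A : Finset (List Bool)} {x p : List Bool} :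
    p ∈ programs U A x ↔ p ∈ A ∧ x ∈ U p :=
  Finset.mem_filter

theorem card_produced_le (U : List Bool →. List Bool) (X A : Finset (List Bool)) :
    (produced U X A).card ≤ A.card := by
  have h : ∀ x, ∃ p, x ∈ produced U X A → p ∈ A ∧ x ∈ U p := by
    intro x
    by_cases hx : ∃ p ∈ A, x ∈ U p
    · obtain ⟨p, hp⟩ := hx
      exact ⟨p, fun _ => hp⟩
    · exact ⟨[], fun h => absurd (mem_produced.1 h).2 hx⟩
  choose g hg using h
  refine Finset.card_le_card_of_injOn g (fun x hx => (hg x hx).1) fun x hx y hy hxy => ?_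
  have h1 := (hg x hx).2
  rw [hxy] at h1
  exact Part.mem_unique h1 (hg y hy).2

/-- Distinct strings have disjoint sets of programs, all inside `A`. -/
theorem card_filter_many_programs_mul_le (U : List Bool →. List Bool)
    (X A : Finset (List Bool)) (b : ℕ) :
    (X.filter fun x => b < (programs U A x).card).card * b ≤ A.card := by
  set Z := X.filter fun x => b < (programs U A x).card
  calc Z.card * b = ∑ _x ∈ Z, b := by rw [Finset.sum_const, smul_eq_mul]
    _ ≤ ∑ x ∈ Z, (programs U A x).card :=
        Finset.sum_le_sum fun x hx => (Finset.mem_filter.1 hx).2.le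
    _ = (Z.biUnion (programs U A)).card := by
        rw [Finset.card_biUnion]
        intro x _ y _ hxy
        rw [Function.onFun, Finset.disjoint_left]
        intro p hx hy
        exact hxy (Part.mem_unique (mem_programs.1 hx).2 (mem_programs.1 hy).2)
    _ ≤ A.card := Finset.card_le_card fun p hp => by
        obtain ⟨x, -, hx⟩ := Finset.mem_biUnion.1 hp
        exact (mem_programs.1 hx).1

theorem complexity_le {U : List Bool →. List Bool} {x p : List Bool} (h : x ∈ U p) :
    complexity U x ≤ p.length :=
  Nat.sInf_le ⟨p, h, rfl⟩

/-- If strings in `S` have complexity at most `s + k`, then one of them escapes the small set `R`,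
has no much shorter programs and not too many programs. -/
theorem exists_typical {U : List Bool →. List Bool} {s h : ℕ} {S R : List (List Bool)}
    (hS : S.length = 2 ^ s) (hnd : S.Nodup) (hR : 8 * R.length ≤ 2 ^ s) :
    ∃ x ∈ S, (∀ p ∈ R, x ∉ U p) ∧ (∀ p : List Bool, x ∈ U p → s ≤ p.length + 3) ∧
      (programs U (shortStrings (s + h + 1)) x).card ≤ 2 ^ (h + 3) := by
  set X := S.toFinset
  have hX : X.card = 2 ^ s := by rw [List.toFinset_card_of_nodup hnd, hS]
  have h1 := card_produced_le U X R.toFinset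
  have h2 := card_produced_le U X (shortStrings (s - 3))
  have h3 := card_filter_many_programs_mul_le U X (shortStrings (s + h + 1)) (2 ^ (h + 3))
  set X1 := produced U X R.toFinset
  set X2 := produced U X (shortStrings (s - 3))
  set X3 := X.filter fun x =>
    2 ^ (h + 3) < (programs U (shortStrings (s + h + 1)) x).card
  have h1' : 8 * X1.card ≤ 2 ^ s := by
    have := List.toFinset_card_le R
    omega
  have h2' : 8 * X2.card ≤ 2 ^ s := by
    have h4 := card_shortStrings (s - 3)
    rcases le_or_gt 3 s with hs | hs
    · obtain ⟨s', rfl⟩ := Nat.exists_eq_add_of_le' hs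
      rw [Nat.add_sub_cancel] at h4
      rw [pow_add]
      have : X2.card ≤ (shortStrings s').card := h2
      omega
    · have h5 : X2.card + 1 ≤ 2 ^ (s - 3) := by omega
      rw [Nat.sub_eq_zero_of_le hs.le] at h5
      omega
  have h3' : 4 * X3.card ≤ 2 ^ s := by
    have h4 := card_shortStrings (s + h + 1)
    have h5 : X3.card * 2 ^ (h + 3) ≤ 2 ^ (s + h + 1) := by omega
    have e1 : (2 : ℕ) ^ (h + 3) = 4 * 2 ^ (h + 1) := by ring
    have e2 : (2 : ℕ) ^ (s + h + 1) = 2 ^ s * 2 ^ (h + 1) := by ring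
    rw [e1, e2] at h5
    refine Nat.le_of_mul_le_mul_right (c := 2 ^ (h + 1)) ?_ (by positivity)
    calc 4 * X3.card * 2 ^ (h + 1) = X3.card * (4 * 2 ^ (h + 1)) := by ring
      _ ≤ _ := h5
  -- The exceptional sets take up at most 1/8 + 1/8 + 1/4 of `X`.
  have hlt : (X1 ∪ X2 ∪ X3).card < X.card := by
    have := Finset.card_union_le (X1 ∪ X2) X3
    have := Finset.card_union_le X1 X2
    have := Nat.one_le_two_pow (n := s)
    omega
  obtain ⟨x, hx, hx'⟩ := Finset.exists_mem_notMem_of_card_lt_card hlt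
  simp only [Finset.mem_union, not_or] at hx'
  refine ⟨x, List.mem_toFinset.1 hx, fun p hp hxp => ?_, fun p hxp => ?_, ?_⟩
  · exact hx'.1.1 (mem_produced.2 ⟨hx, p, List.mem_toFinset.2 hp, hxp⟩)
  · by_contra hs
    exact hx'.1.2 (mem_produced.2 ⟨hx, p, mem_shortStrings.2 (by omega), hxp⟩)
  · by_contra hc
    exact hx'.2 (Finset.mem_filter.2 ⟨hx, not_le.1 hc⟩)

open Classical in
/-- A trap for the outputs of a list-approximating algorithm contains a string of larger
complexity. -/
theorem ListApproximates.exists_complex_of_trap {U : List Bool →. List Bool}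
    {F : List Bool × List Bool →. List (List Bool)} {T r c : ℕ → ℕ}
    (hF : ListApproximates U F T r c) {f : List Bool → List Bool → List (List Bool)}
    (hf : ∀ x ρ, ρ.length = r x.length → f x ρ ∈ F (x, ρ)) {k n s : ℕ} {S R : List (List Bool)}
    (ht : Trap (fun x => (strings (r x.length)).map (f x)) (k + c n) n s S R) :
    ∃ x ∈ S, ∀ p, x ∈ U p → s + k < p.length := by
  obtain ⟨hS, hnd, hlen, hR, hhits⟩ := ht
  obtain ⟨x, hx, hxR, hxs, hxm⟩ := exists_typical (U := U) (h := k + c n) hS hnd hR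
  refine ⟨x, hx, fun p₀ hp₀ => ?_⟩
  by_contra hk
  have hxn := hlen x hx
  set h := k + c n with hh
  set P := programs U (shortStrings (s + h + 1)) x with hP
  set Ω := cube (r n) with hΩ
  have hhalf := hF.half x
  have hset : {ρ : List Bool | ρ.length = r x.length ∧
      ∃ L ∈ F (x, ρ), ∃ p ∈ L, IsShortProgram U (c x.length) x p} =
      (Ω.filter fun ρ => ∃ p ∈ f x ρ, IsShortProgram U (c n) x p : Finset (List Bool)) := by
    ext ρ
    simp only [Set.mem_ofPred_eq, Finset.coe_filter, hΩ, mem_cube, hxn]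
    refine and_congr_right fun hρ => ⟨?_, fun h => ⟨_, hf x ρ (by rw [hρ, hxn]), h⟩⟩
    rintro ⟨L, hL, h⟩
    rwa [Part.mem_unique (hf x ρ (by rw [hρ, hxn])) hL]
  rw [hset, Set.ncard_coe_finset, hxn] at hhalf
  set Y := (strings (r x.length)).map (f x) with hY
  have hx4 : 4 * (Ω.filter fun ρ => ∃ p ∈ f x ρ, Relevant s h R Y p).card < 2 ^ r n := by
    have h1 : 4 * (hits s h R Y).length < Y.length := hhits x hx
    have h2 : (hits s h R Y).length = _ := length_filter_map_strings (r x.length) (f x)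
      fun l => ∃ p ∈ l, Relevant s h R Y p
    have h3 : Y.length = 2 ^ r n := by rw [hY, List.length_map, length_strings, hxn]
    have h4 : cube (r x.length) = Ω := by rw [hxn]
    rwa [h2, h3, h4] at h1
  set L := P.filter fun p => ¬ Heavy (h + 5) Y p with hL
  -- A short program for `x` has length at most `s + k + c n = s + h`, so it is either relevant or
  -- one of the light programs in `L`.
  have hsub : (Ω.filter fun ρ => ∃ p ∈ f x ρ, IsShortProgram U (c n) x p) ⊆
      (Ω.filter fun ρ => ∃ p ∈ f x ρ, Relevant s h R Y p) ∪
        L.biUnion fun p => Ω.filter fun ρ => p ∈ f x ρ := by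
    intro ρ hρ
    obtain ⟨hρ, p, hp, hpU, hpl⟩ := Finset.mem_filter.1 hρ
    have h1 := complexity_le hp₀
    have hps : p.length ≤ s + h := by omega
    rw [Finset.mem_union]
    by_cases hheavy : Heavy (h + 5) Y p
    · exact Or.inl (Finset.mem_filter.2 ⟨hρ, p, hp, hxs p hpU, hps,
        fun hpR => hxR p hpR hpU, hheavy⟩)
    · refine Or.inr (Finset.mem_biUnion.2 ⟨p, Finset.mem_filter.2 ⟨mem_programs.2
        ⟨mem_shortStrings.2 (by omega), hpU⟩, hheavy⟩, Finset.mem_filter.2 ⟨hρ, hp⟩⟩)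
  have hcard := (Finset.card_le_card hsub).trans (Finset.card_union_le _ _)
  have hlight : 4 * (L.biUnion fun p => Ω.filter fun ρ => p ∈ f x ρ).card ≤ 2 ^ r n := by
    have h1 : ∀ p ∈ L, 2 ^ (h + 5) * (Ω.filter fun ρ => p ∈ f x ρ).card ≤ 2 ^ r n := by
      intro p hp
      have := (Finset.mem_filter.1 hp).2
      rw [Heavy, hY, length_filter_map_strings, List.length_map, length_strings, hxn,
        not_le] at this
      exact this.le
    have h2 : 2 ^ (h + 5) * (L.biUnion fun p => Ω.filter fun ρ => p ∈ f x ρ).card ≤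
        2 ^ (h + 3) * 2 ^ r n := by
      calc _ ≤ 2 ^ (h + 5) * ∑ p ∈ L, (Ω.filter fun ρ => p ∈ f x ρ).card :=
            Nat.mul_le_mul_left _ Finset.card_biUnion_le
        _ = ∑ p ∈ L, 2 ^ (h + 5) * (Ω.filter fun ρ => p ∈ f x ρ).card := by
            rw [Finset.mul_sum]
        _ ≤ ∑ _p ∈ L, 2 ^ r n := Finset.sum_le_sum h1
        _ = L.card * 2 ^ r n := by rw [Finset.sum_const, smul_eq_mul]
        _ ≤ _ := Nat.mul_le_mul_right _ ((Finset.card_filter_le _ _).trans hxm)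
    refine Nat.le_of_mul_le_mul_left (c := 2 ^ (h + 3)) ?_ (by positivity)
    refine le_trans (le_of_eq ?_) h2
    ring
  omega

/-! ### Capturing sets and averaging -/

/-- Bernoulli gives `(1 + 1/m) ^ (2D) ≥ 1 + 2u` with `u = D/m`, and `(1 - 1/m)(1 + 1/m) ≤ 1`. So the
left side is at most `1 / (1 + 2u)`, which is at most `1 - u` because `2u ≤ 1`. -/
theorem one_sub_inv_pow_le {m D : ℕ} (hm : 0 < m) (h : 2 * D ≤ m) :
    (1 - 1 / (m : ℝ)) ^ (2 * D) ≤ 1 - D / m := by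
  have hm' : (0 : ℝ) < m := by exact_mod_cast hm
  set u : ℝ := D / m with hu
  have hu0 : 0 ≤ u := by positivity
  have hu1 : 2 * u ≤ 1 := by
    rw [hu, mul_div_assoc', div_le_one hm']
    exact_mod_cast h
  have hi : 1 / (m : ℝ) ≤ 1 := by
    rw [div_le_one hm']
    exact_mod_cast hm
  have hi0 : 0 ≤ 1 / (m : ℝ) := by positivity
  set a : ℝ := (1 - 1 / (m : ℝ)) ^ (2 * D)
  have ha0 : 0 ≤ a := pow_nonneg (by linarith) _
  have hb : 1 + 2 * u ≤ (1 + 1 / (m : ℝ)) ^ (2 * D) := by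
    have := one_add_mul_le_pow (a := 1 / (m : ℝ)) (by linarith) (2 * D)
    refine le_trans (le_of_eq ?_) this
    rw [hu]
    push_cast
    ring
  have hab : a * (1 + 1 / (m : ℝ)) ^ (2 * D) ≤ 1 := by
    rw [← mul_pow]
    refine pow_le_one₀ (mul_nonneg (by linarith) (by linarith)) ?_
    nlinarith
  have h1 : a * (1 + 2 * u) ≤ 1 := (mul_le_mul_of_nonneg_left hb ha0).trans hab
  by_contra hlt
  push Not at hlt
  nlinarith

/-- Few small subsets of `W` can be captured simultaneously by a much smaller set `R`. -/
theorem exists_subset_capturing {α β : Type*} [DecidableEq β] {ρ D : ℕ} (hD : 2 * D ≤ ρ)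
    (hρ : 0 < ρ) (N : α → Finset β) (d : ℕ) :
    ∀ (W : Finset β) (X : Finset α), W.card = ρ + d → (∀ x ∈ X, N x ⊆ W ∧ (N x).card ≤ D) →
      ∃ R ⊆ W, R.card = ρ ∧
        X.card * ρ ^ (2 * D) ≤ (X.filter fun x => N x ⊆ R).card * W.card ^ (2 * D) := by
  induction d with
  | zero =>
    intro W X hW hN
    refine ⟨W, subset_rfl, hW, ?_⟩
    rw [Finset.filter_true_of_mem fun x hx => (hN x hx).1, hW, add_zero]
  | succ d ih =>
    intro W X hW hN
    set m := W.card with hm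
    have hsum : ∑ p ∈ W, (X.filter fun x => p ∈ N x).card ≤ D * X.card := by
      have h1 := Finset.sum_card_bipartiteAbove_eq_sum_card_bipartiteBelow
        (s := W) (t := X) fun p x => p ∈ N x
      simp only [Finset.bipartiteAbove, Finset.bipartiteBelow] at h1
      rw [h1, mul_comm, ← smul_eq_mul, ← Finset.sum_const]
      refine Finset.sum_le_sum fun x hx => le_trans (Finset.card_le_card ?_) (hN x hx).2
      exact fun p hp => (Finset.mem_filter.1 hp).2
    have hWne : W.Nonempty := by
      rw [← Finset.card_pos]
      omega
    -- Greedy step: deleting the element that lies in the fewest sets `N x` loses at most a fraction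
    -- `D / m` of `X`. By `one_sub_inv_pow_le` the survivors number at least `((m - 1) / m) ^ (2D)`
    -- times `X.card`, and these factors telescope down to `ρ`.
    obtain ⟨p, hp, hpc⟩ : ∃ p ∈ W, m * (X.filter fun x => p ∈ N x).card ≤ D * X.card := by
      obtain ⟨p, hp, hmin⟩ := W.exists_min_image (fun p => (X.filter fun x => p ∈ N x).card) hWne
      refine ⟨p, hp, le_trans ?_ hsum⟩
      rw [hm, ← smul_eq_mul, ← Finset.sum_const]
      exact Finset.sum_le_sum hmin
    have hcard := Finset.card_filter_add_card_filter_not (s := X) fun x => p ∈ N x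
    set X' := X.filter fun x => ¬ p ∈ N x with hX'
    have hW' : (W.erase p).card = ρ + d := by
      rw [Finset.card_erase_of_mem hp]
      omega
    obtain ⟨R, hR, hRc, hRX⟩ := ih (W.erase p) X' hW' fun x hx => by
      obtain ⟨hxX, hxp⟩ := Finset.mem_filter.1 hx
      exact ⟨Finset.subset_erase.2 ⟨(hN x hxX).1, hxp⟩, (hN x hxX).2⟩
    refine ⟨R, hR.trans (Finset.erase_subset _ _), hRc, ?_⟩
    have hmono : (X'.filter fun x => N x ⊆ R).card ≤ (X.filter fun x => N x ⊆ R).card :=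
      Finset.card_le_card (Finset.filter_subset_filter _ (Finset.filter_subset _ _))
    have hm1 : (W.erase p).card + 1 = m := by omega
    have hmpos : 0 < m := by omega
    have hmR : (0 : ℝ) < m := by exact_mod_cast hmpos
    have key := one_sub_inv_pow_le hmpos (show 2 * D ≤ m by omega)
    have hX'R : (X.card : ℝ) * (1 - D / m) ≤ X'.card := by
      have h1 : (m : ℝ) * (X.card - X'.card) ≤ D * X.card := by
        have h2 : (X.card : ℝ) - X'.card = (X.filter fun x => p ∈ N x).card := by
          rw [← hcard]
          push_cast
          ring
        rw [h2]
        exact_mod_cast hpc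
      have h3 : (X.card : ℝ) * (1 - D / m) = X.card - D * X.card / m := by ring
      rw [h3, sub_le_iff_le_add, ← sub_le_iff_le_add', le_div_iff₀ hmR]
      linarith
    have hstep : X.card * (W.erase p).card ^ (2 * D) ≤ X'.card * m ^ (2 * D) := by
      have h1 : ((W.erase p).card : ℝ) = m * (1 - 1 / m) := by
        rw [← hm1]
        push_cast
        field_simp
        ring
      have h2 : (X.card : ℝ) * ((W.erase p).card : ℝ) ^ (2 * D) ≤ X'.card * (m : ℝ) ^ (2 * D) := by
        rw [h1, mul_pow, mul_left_comm, mul_comm (X'.card : ℝ)]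
        refine mul_le_mul_of_nonneg_left ?_ (by positivity)
        exact (mul_le_mul_of_nonneg_left key (Nat.cast_nonneg _)).trans hX'R
      exact_mod_cast h2
    have hpos : 0 < (W.erase p).card ^ (2 * D) := by
      apply pow_pos
      omega
    refine Nat.le_of_mul_le_mul_right (c := (W.erase p).card ^ (2 * D)) ?_ hpos
    calc X.card * ρ ^ (2 * D) * (W.erase p).card ^ (2 * D)
        = X.card * (W.erase p).card ^ (2 * D) * ρ ^ (2 * D) := by ring
      _ ≤ X'.card * m ^ (2 * D) * ρ ^ (2 * D) := Nat.mul_le_mul_right _ hstep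
      _ = X'.card * ρ ^ (2 * D) * m ^ (2 * D) := by ring
      _ ≤ (X'.filter fun x => N x ⊆ R).card * (W.erase p).card ^ (2 * D) * m ^ (2 * D) :=
          Nat.mul_le_mul_right _ hRX
      _ ≤ (X.filter fun x => N x ⊆ R).card * (W.erase p).card ^ (2 * D) * m ^ (2 * D) :=
          Nat.mul_le_mul_right _ (Nat.mul_le_mul_right _ hmono)
      _ = _ := by ring

open Classical in
theorem card_filter_mostly_le {ι α : Type*} (I : Finset ι) {X : Finset α} (hX : X.Nonempty)
    (B : ι → α → Prop) {m : ℕ} (h : ∀ x ∈ X, (I.filter fun s => B s x).card ≤ m) :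
    (I.filter fun s => X.card < 2 * (X.filter fun x => B s x).card).card ≤ 2 * m := by
  set J := I.filter fun s => X.card < 2 * (X.filter fun x => B s x).card
  have h1 : J.card * X.card ≤ 2 * (X.card * m) := by
    calc J.card * X.card = ∑ _s ∈ J, X.card := by rw [Finset.sum_const, smul_eq_mul]
      _ ≤ ∑ s ∈ J, 2 * (X.filter fun x => B s x).card :=
          Finset.sum_le_sum fun s hs => (Finset.mem_filter.1 hs).2.le
      _ ≤ ∑ s ∈ I, 2 * (X.filter fun x => B s x).card :=
          Finset.sum_le_sum_of_subset (Finset.filter_subset _ _)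
      _ = 2 * ∑ x ∈ X, (I.filter fun s => B s x).card := by
          rw [← Finset.mul_sum]
          congr 1
          exact Finset.sum_card_bipartiteAbove_eq_sum_card_bipartiteBelow B
      _ ≤ 2 * ∑ _x ∈ X, m := Nat.mul_le_mul_left _ (Finset.sum_le_sum h)
      _ = _ := by rw [Finset.sum_const, smul_eq_mul]
  refine Nat.le_of_mul_le_mul_right (c := X.card) ?_ (Finset.card_pos.2 hX)
  linarith

/-- A string of length `l` is counted only for `s` between `l - h` and `l + 3`. -/
theorem sum_card_window_le (I : Finset ℕ) (P : Finset (List Bool)) (h : ℕ) :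
    ∑ s ∈ I, (P.filter fun p => s ≤ p.length + 3 ∧ p.length ≤ s + h).card ≤
      (h + 4) * P.card := by
  have h1 := Finset.sum_card_bipartiteAbove_eq_sum_card_bipartiteBelow (s := I) (t := P)
    fun (s : ℕ) (p : List Bool) => s ≤ p.length + 3 ∧ p.length ≤ s + h
  simp only [Finset.bipartiteAbove, Finset.bipartiteBelow] at h1
  rw [h1, mul_comm, ← smul_eq_mul, ← Finset.sum_const]
  refine Finset.sum_le_sum fun p _ => ?_
  calc _ ≤ (Finset.Icc (p.length - h) (p.length + 3)).card :=
        Finset.card_le_card fun s hs => by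
          have := (Finset.mem_filter.1 hs).2
          rw [Finset.mem_Icc]
          omega
    _ ≤ h + 4 := by
        rw [Nat.card_Icc]
        omega

section Lists

variable {m T : ℕ} {g : List Bool → List (List Bool)}

/-- The lists have `2 ^ m * T` entries in all. A heavy string occurs in at least one list, and in at
least `2 ^ (m - b)` of them (as a real fraction); the two counts give the two arguments of the
minimum. -/
theorem card_heavy_le (hg : ∀ ρ ∈ cube m, (g ρ).toFinset.card = T) {b : ℕ}
    {H : Finset (List Bool)} (hH : ∀ p ∈ H, Heavy b ((strings m).map g) p) :
    H.card ≤ T * 2 ^ min m b := by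
  have hsum : ∑ p ∈ H, ((cube m).filter fun ρ => p ∈ g ρ).card ≤ 2 ^ m * T := by
    have h1 := Finset.sum_card_bipartiteAbove_eq_sum_card_bipartiteBelow (s := H) (t := cube m)
      fun p ρ => p ∈ g ρ
    simp only [Finset.bipartiteAbove, Finset.bipartiteBelow] at h1
    rw [h1, ← card_cube, ← smul_eq_mul, ← Finset.sum_const]
    refine Finset.sum_le_sum fun ρ hρ => ?_
    rw [← hg ρ hρ]
    exact Finset.card_le_card fun p hp => List.mem_toFinset.2 (Finset.mem_filter.1 hp).2
  have hheavy : ∀ p ∈ H, 2 ^ m ≤ 2 ^ b * ((cube m).filter fun ρ => p ∈ g ρ).card := by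
    intro p hp
    have := hH p hp
    rwa [Heavy, length_filter_map_strings, List.length_map, length_strings] at this
  have h1 : H.card ≤ 2 ^ m * T := by
    refine le_trans ?_ hsum
    rw [Finset.card_eq_sum_ones]
    refine Finset.sum_le_sum fun p hp => Nat.one_le_iff_ne_zero.2 fun h0 => ?_
    have := hheavy p hp
    rw [h0, mul_zero] at this
    simp at this
  have h2 : H.card ≤ 2 ^ b * T := by
    refine Nat.le_of_mul_le_mul_right (c := 2 ^ m) ?_ (by positivity)
    calc H.card * 2 ^ m = ∑ _p ∈ H, 2 ^ m := by rw [Finset.sum_const, smul_eq_mul]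
      _ ≤ ∑ p ∈ H, 2 ^ b * ((cube m).filter fun ρ => p ∈ g ρ).card := Finset.sum_le_sum hheavy
      _ ≤ 2 ^ b * (2 ^ m * T) := by
          rw [← Finset.mul_sum]
          exact Nat.mul_le_mul_left _ hsum
      _ = _ := by ring
  rcases min_choice m b with h | h <;> rw [h, mul_comm] <;> assumption

/-- The heavy strings in `Y` of length between `s - 3` and `s + h`. -/
def relevantSet (s h : ℕ) (Y : List (List (List Bool))) : Finset (List Bool) :=
  (shortStrings (s + h + 1)).filter fun p => Relevant s h [] Y p

theorem mem_relevantSet {s h : ℕ} {Y : List (List (List Bool))} {p : List Bool} :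
    p ∈ relevantSet s h Y ↔ Relevant s h [] Y p := by
  rw [relevantSet, Finset.mem_filter, mem_shortStrings]
  exact and_iff_right_of_imp fun h => Nat.lt_succ_of_le h.2.1

theorem sum_card_relevantSet_le (hg : ∀ ρ ∈ cube m, (g ρ).toFinset.card = T) (h : ℕ)
    (I : Finset ℕ) :
    ∑ s ∈ I, (relevantSet s h ((strings m).map g)).card ≤
      (h + 4) * (T * 2 ^ min m (h + 5)) := by
  set Y := (strings m).map g
  set H := I.biUnion fun s => relevantSet s h Y
  have hH : ∀ p ∈ H, Heavy (h + 5) Y p := by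
    intro p hp
    obtain ⟨s, -, hs⟩ := Finset.mem_biUnion.1 hp
    exact (mem_relevantSet.1 hs).2.2.2
  calc _ ≤ ∑ s ∈ I, (H.filter fun p => s ≤ p.length + 3 ∧ p.length ≤ s + h).card := by
        refine Finset.sum_le_sum fun s hs => Finset.card_le_card fun p hp => ?_
        have := mem_relevantSet.1 hp
        exact Finset.mem_filter.2 ⟨Finset.mem_biUnion.2 ⟨s, hs, hp⟩, this.1, this.2.1⟩
    _ ≤ (h + 4) * H.card := sum_card_window_le I H h
    _ ≤ _ := Nat.mul_le_mul_left _ (card_heavy_le hg hH)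

theorem sum_length_hits_le (hg : ∀ ρ ∈ cube m, (g ρ).toFinset.card = T) (h : ℕ)
    (I : Finset ℕ) :
    ∑ s ∈ I, (hits s h [] ((strings m).map g)).length ≤ (h + 4) * T * 2 ^ m := by
  set Y := (strings m).map g with hY
  have h1 : ∀ s, (hits s h [] Y).length ≤ ∑ ρ ∈ cube m,
      ((g ρ).toFinset.filter fun p => s ≤ p.length + 3 ∧ p.length ≤ s + h).card := by
    intro s
    have h2 : (hits s h [] Y).length = _ := length_filter_map_strings m g
      fun l => ∃ p ∈ l, Relevant s h [] Y p
    rw [h2, Finset.card_filter]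
    refine Finset.sum_le_sum fun ρ _ => ?_
    split_ifs with hρ
    · obtain ⟨p, hp, hr⟩ := hρ
      exact Finset.card_pos.2 ⟨p, Finset.mem_filter.2 ⟨List.mem_toFinset.2 hp, hr.1, hr.2.1⟩⟩
    · exact Nat.zero_le _
  calc _ ≤ ∑ s ∈ I, ∑ ρ ∈ cube m,
        ((g ρ).toFinset.filter fun p => s ≤ p.length + 3 ∧ p.length ≤ s + h).card :=
        Finset.sum_le_sum fun s _ => h1 s
    _ = ∑ ρ ∈ cube m, ∑ s ∈ I,
        ((g ρ).toFinset.filter fun p => s ≤ p.length + 3 ∧ p.length ≤ s + h).card :=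
        Finset.sum_comm
    _ ≤ ∑ _ρ ∈ cube m, (h + 4) * T := Finset.sum_le_sum fun ρ hρ => by
        rw [← hg ρ hρ]
        exact sum_card_window_le I _ h
    _ = _ := by rw [Finset.sum_const, smul_eq_mul, card_cube, mul_comm]

end Lists

/-! ### Traps exist for many lengths -/

theorem exists_trap_of_card {G : List Bool → List (List (List Bool))} {h n s : ℕ}
    {Z : Finset (List Bool)} (hZ : Z ⊆ cube n) (hs : 2 ^ s ≤ Z.card) {R : List (List Bool)}
    (hR : 8 * R.length ≤ 2 ^ s)
    (hh : ∀ x ∈ Z, 4 * (hits s h R (G x)).length < (G x).length) :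
    ∃ S, Trap G h n s S R := by
  obtain ⟨S, hSZ, hS⟩ := Finset.exists_subset_card_eq hs
  refine ⟨S.toList, by rw [Finset.length_toList, hS], S.nodup_toList, fun x hx => ?_, hR,
    fun x hx => ?_⟩
  · exact mem_cube.1 (hZ (hSZ (Finset.mem_toList.1 hx)))
  · exact hh x (hSZ (Finset.mem_toList.1 hx))

/-- Take `R` of size `2 ^ (s - 3)` among the strings of length at most `s + h`. Since these number
less than `2 ^ (h + 4) * 2 ^ (s - 3)`, at least a fraction `2 ^ (-2D(h + 4))` of `Z` has all its
relevant strings in `R`, which leaves `2 ^ s` strings with no hits at all. -/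
theorem exists_trap_of_few_relevant {G : List Bool → List (List (List Bool))} {h n s D : ℕ}
    {Z : Finset (List Bool)} (hZ : Z ⊆ cube n) (hZc : 2 ^ n ≤ 2 * Z.card)
    (hG : ∀ x ∈ Z, 0 < (G x).length) (hD : ∀ x ∈ Z, (relevantSet s h (G x)).card ≤ D)
    (hs3 : 3 ≤ s) (hDs : 2 * D ≤ 2 ^ (s - 3)) (hn : s + 2 * D * (h + 4) + 1 ≤ n) :
    ∃ S R, Trap G h n s S R := by
  set W := shortStrings (s + h + 1)
  have hWc : W.card + 1 = 2 ^ (s + h + 1) := card_shortStrings _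
  have hle : 2 ^ (s - 3) + 1 ≤ 2 ^ (s + h + 1) := by
    have : 2 ^ (s - 3) < 2 ^ (s + h + 1) := Nat.pow_lt_pow_right (by norm_num) (by omega)
    omega
  obtain ⟨d, hd⟩ := Nat.exists_eq_add_of_le (show 2 ^ (s - 3) ≤ W.card by omega)
  obtain ⟨R, -, hRc, hRZ⟩ := exists_subset_capturing hDs (by positivity)
    (fun x => relevantSet s h (G x)) d W Z hd fun x hx => ⟨Finset.filter_subset _ _, hD x hx⟩
  set Z' := Z.filter fun x => relevantSet s h (G x) ⊆ R
  have hZ' : 2 ^ s ≤ Z'.card := by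
    have h1 : Z.card * (2 ^ (s - 3)) ^ (2 * D) ≤
        Z'.card * 2 ^ (2 * D * (h + 4)) * (2 ^ (s - 3)) ^ (2 * D) := by
      refine hRZ.trans ?_
      rw [mul_assoc]
      refine Nat.mul_le_mul_left _ ?_
      calc W.card ^ (2 * D) ≤ (2 ^ (s + h + 1)) ^ (2 * D) := Nat.pow_le_pow_left (by omega) _
        _ = (2 ^ (h + 4) * 2 ^ (s - 3)) ^ (2 * D) := by
            rw [← pow_add]
            congr 2
            omega
        _ = _ := by rw [mul_pow, ← pow_mul, mul_comm (h + 4)]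
    have h2 := Nat.le_of_mul_le_mul_right h1 (by positivity)
    refine Nat.le_of_mul_le_mul_right (c := 2 ^ (2 * D * (h + 4) + 1)) ?_ (by positivity)
    calc 2 ^ s * 2 ^ (2 * D * (h + 4) + 1) = 2 ^ (s + 2 * D * (h + 4) + 1) := by
          rw [← pow_add, add_assoc]
      _ ≤ 2 ^ n := Nat.pow_le_pow_right (by norm_num) hn
      _ ≤ 2 * (Z'.card * 2 ^ (2 * D * (h + 4))) := by omega
      _ = _ := by ring
  obtain ⟨S, hS⟩ := exists_trap_of_card (G := G) (h := h) (R := R.toList)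
    ((Finset.filter_subset _ _).trans hZ) hZ' (by
      rw [Finset.length_toList, hRc]
      refine le_of_eq ?_
      rw [show 8 = 2 ^ 3 from rfl, ← pow_add]
      congr 1
      omega) fun x hx => by
    obtain ⟨hxZ, hxR⟩ := Finset.mem_filter.1 hx
    have h0 : hits s h R.toList (G x) = [] := by
      rw [hits, List.filter_eq_nil_iff]
      simp only [decide_eq_true_eq]
      rintro l - ⟨p, -, h1, h2, h3, h4⟩
      exact h3 (Finset.mem_toList.2 (hxR (mem_relevantSet.2 ⟨h1, h2, by simp, h4⟩)))
    rw [h0]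
    exact hG x hxZ
  exact ⟨S, _, hS⟩

open Classical in
/-- If every string of length `n` is bad for a small fraction of all `s`, and the majority of
strings being good for `s` implies `Q s`, then `Q` is dense. -/
theorem card_filter_ge {n : ℕ} (B : ℕ → List Bool → Prop) (Q : ℕ → Prop)
    (hB : ∀ x ∈ cube n, 16 * ((Finset.Ico (n / 4) (n / 2)).filter fun s => B s x).card ≤ n)
    (hQ : ∀ s ∈ Finset.Ico (n / 4) (n / 2), ∀ Z ⊆ cube n, 2 ^ n ≤ 2 * Z.card →
      (∀ x ∈ Z, ¬ B s x) → Q s) :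
    n ≤ 8 * ((Finset.Ico (n / 4) (n / 2)).filter Q).card + 4 := by
  set I := Finset.Ico (n / 4) (n / 2)
  -- The interval has about `n / 4` elements, and averaging discards at most `2 * (n / 16)` of them.
  have h1 := card_filter_mostly_le I (X := cube n)
    (by rw [← Finset.card_pos, card_cube]; positivity) B (m := n / 16)
    fun x hx => by have := hB x hx; omega
  have h2 : I.filter (fun s => ¬ (cube n).card < 2 * ((cube n).filter fun x => B s x).card) ⊆
      I.filter Q := by
    intro s hs
    obtain ⟨hsI, hs⟩ := Finset.mem_filter.1 hs
    refine Finset.mem_filter.2 ⟨hsI, hQ s hsI ((cube n).filter fun x => ¬ B s x)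
      (Finset.filter_subset _ _) ?_ fun x hx => (Finset.mem_filter.1 hx).2⟩
    have := Finset.card_filter_add_card_filter_not (s := cube n) fun x => B s x
    rw [card_cube] at *
    omega
  have h3 := Finset.card_le_card h2
  have h4 := Finset.card_filter_add_card_filter_not (s := I)
    fun s => (cube n).card < 2 * ((cube n).filter fun x => B s x).card
  have h5 : I.card = n / 2 - n / 4 := Nat.card_Ico _ _
  omega

theorem le_two_pow_div_four {n : ℕ} (hn : 20 ≤ n) : n ≤ 2 ^ (n / 4) := by
  have h : ∀ q, 5 ≤ q → 4 * q + 3 ≤ 2 ^ q := by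
    intro q hq
    induction q, hq using Nat.le_induction with
    | base => norm_num
    | succ q hq ih => rw [pow_succ]; omega
  have := h (n / 4) (by omega)
  omega

theorem sixteen_mul_log_le {n : ℕ} (hn : 128 ≤ n) : 16 * Nat.log 2 n ≤ n := by
  have h : ∀ q, 7 ≤ q → 16 * q ≤ 2 ^ q := by
    intro q hq
    induction q, hq using Nat.le_induction with
    | base => norm_num
    | succ q hq ih => rw [pow_succ]; omega
  rcases le_or_gt 7 (Nat.log 2 n) with h7 | h7
  · exact (h _ h7).trans (Nat.pow_log_le_self 2 (by omega))
  · omega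

section Density

variable {f : List Bool → List Bool → List (List Bool)} {T r : ℕ → ℕ} {n : ℕ}

open Classical in
theorem card_trapping_of_sq_le
    (hT : ∀ x ∈ cube n, ∀ ρ ∈ cube (r n), (f x ρ).toFinset.card = T n) (hn : 20 ≤ n) {h : ℕ}
    (hle : 64 * (h + 4) ^ 2 * (T n * 2 ^ min (r n) (h + 5)) ≤ n ^ 2) :
    n ≤ 8 * ((Finset.Ico (n / 4) (n / 2)).filter fun s => ∃ S R,
      Trap (fun x => (strings (r x.length)).map (f x)) h n s S R).card + 4 := by
  set G := fun x => (strings (r x.length)).map (f x)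
  have hG : ∀ x ∈ cube n, G x = (strings (r n)).map (f x) := fun x hx => by
    simp only [G, mem_cube.1 hx]
  -- Small enough that `2D(h + 4) ≤ n / 2`, leaving room for `s < n / 2` in the exponent; large
  -- enough that Markov's inequality leaves at most `n / 16` bad lengths.
  set D := n / (4 * (h + 4)) with hD
  have hD1 : n ≤ (D + 1) * (4 * (h + 4)) := by
    have := Nat.lt_div_mul_add (a := n) (b := 4 * (h + 4)) (by omega)
    rw [add_mul, one_mul]
    exact this.le
  have hD2 : D * (4 * (h + 4)) ≤ n := Nat.div_mul_le_self _ _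
  refine card_filter_ge (fun s x => D < (relevantSet s h (G x)).card) _ (fun x hx => ?_) ?_
  · set J := (Finset.Ico (n / 4) (n / 2)).filter fun s => D < (relevantSet s h (G x)).card
    suffices hJ : 16 * J.card ≤ n by convert hJ
    have h1 : J.card * (D + 1) ≤ (h + 4) * (T n * 2 ^ min (r n) (h + 5)) := by
      calc J.card * (D + 1) = ∑ _s ∈ J, (D + 1) := by rw [Finset.sum_const, smul_eq_mul]
        _ ≤ ∑ s ∈ J, (relevantSet s h (G x)).card :=
            Finset.sum_le_sum fun s hs => (Finset.mem_filter.1 hs).2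
        _ ≤ _ := by
            rw [hG x hx]
            exact sum_card_relevantSet_le (hT x hx) h J
    refine Nat.le_of_mul_le_mul_right (c := n) ?_ (by omega)
    calc 16 * J.card * n ≤ 16 * J.card * ((D + 1) * (4 * (h + 4))) := Nat.mul_le_mul_left _ hD1
      _ = J.card * (D + 1) * (64 * (h + 4)) := by ring
      _ ≤ (h + 4) * (T n * 2 ^ min (r n) (h + 5)) * (64 * (h + 4)) := Nat.mul_le_mul_right _ h1
      _ = 64 * (h + 4) ^ 2 * (T n * 2 ^ min (r n) (h + 5)) := by ring
      _ ≤ n ^ 2 := hle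
      _ = n * n := sq n
  · intro s hs Z hZ hZc hZB
    rw [Finset.mem_Ico] at hs
    refine exists_trap_of_few_relevant hZ hZc (fun x hx => ?_) (fun x hx => not_lt.1 (hZB x hx))
      (by omega) ?_ ?_
    · rw [hG x (hZ hx), List.length_map, length_strings]
      positivity
    · have h1 : 16 * D ≤ n := by nlinarith
      have h2 := le_two_pow_div_four hn
      have h3 : 2 ^ (n / 4) ≤ 2 ^ s := Nat.pow_le_pow_right (by norm_num) hs.1
      have h4 : 2 ^ s = 8 * 2 ^ (s - 3) := by
        rw [show 8 = 2 ^ 3 from rfl, ← pow_add]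
        congr 1
        omega
      omega
    · have h1 : 2 * (2 * D * (h + 4)) ≤ n := le_trans (le_of_eq (by ring)) hD2
      omega

open Classical in
-- Each list has `T n` members, each in at most `h + 4` length windows, so for most `s` few lists
-- are hit even with `R` empty.
theorem card_trapping_of_mul_le
    (hT : ∀ x ∈ cube n, ∀ ρ ∈ cube (r n), (f x ρ).toFinset.card = T n) (hn : 20 ≤ n) {h : ℕ}
    (hle : 64 * (h + 4) * T n ≤ n) :
    n ≤ 8 * ((Finset.Ico (n / 4) (n / 2)).filter fun s => ∃ S R,
      Trap (fun x => (strings (r x.length)).map (f x)) h n s S R).card + 4 := by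
  set G := fun x => (strings (r x.length)).map (f x)
  have hG : ∀ x ∈ cube n, G x = (strings (r n)).map (f x) := fun x hx => by
    simp only [G, mem_cube.1 hx]
  have hlen : ∀ x ∈ cube n, (G x).length = 2 ^ r n := fun x hx => by
    rw [hG x hx, List.length_map, length_strings]
  refine card_filter_ge (fun s x => (G x).length ≤ 4 * (hits s h [] (G x)).length) _
    (fun x hx => ?_) ?_
  · set J := (Finset.Ico (n / 4) (n / 2)).filter
      fun s => (G x).length ≤ 4 * (hits s h [] (G x)).length
    suffices hJ : 16 * J.card ≤ n by convert hJ
    have h1 : J.card * 2 ^ r n ≤ 4 * ((h + 4) * T n * 2 ^ r n) := by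
      calc J.card * 2 ^ r n = ∑ _s ∈ J, 2 ^ r n := by rw [Finset.sum_const, smul_eq_mul]
        _ ≤ ∑ s ∈ J, 4 * (hits s h [] (G x)).length := by
            rw [← hlen x hx]
            exact Finset.sum_le_sum fun s hs => (Finset.mem_filter.1 hs).2
        _ ≤ _ := by
            rw [← Finset.mul_sum, hG x hx]
            exact Nat.mul_le_mul_left _ (sum_length_hits_le (hT x hx) h J)
    have h2 : J.card ≤ 4 * ((h + 4) * T n) := by
      refine Nat.le_of_mul_le_mul_right (c := 2 ^ r n) ?_ (by positivity)
      linarith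
    linarith
  · intro s hs Z hZ hZc hZB
    rw [Finset.mem_Ico] at hs
    have h1 : 2 ^ s ≤ Z.card := by
      have h2 : 2 ^ (s + 1) ≤ 2 ^ n := Nat.pow_le_pow_right (by norm_num) (by omega)
      rw [pow_succ] at h2
      omega
    obtain ⟨S, hS⟩ := exists_trap_of_card (G := G) (h := h) (R := []) hZ h1 (by simp)
      fun x hx => not_le.1 (hZB x hx)
    exact ⟨S, [], hS⟩

end Density

/-! ### The combinatorial bounds -/

/-- The combinatorial form of the lower bounds. -/
theorem exists_bounds {U : List Bool →. List Bool} (hU : IsStandard U) :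
    ∃ k : ℕ, ∀ (F : List Bool × List Bool →. List (List Bool)) (T r c : ℕ → ℕ),
      ListApproximates U F T r c → ∀ᶠ n in atTop,
        n ^ 2 < 64 * (k + c n + 4) ^ 2 * (T n * 2 ^ min (r n) (k + c n + 5)) ∧
        n < 64 * (k + c n + 4) * T n := by
  classical
  obtain ⟨k, hk⟩ := exists_overhead hU
  refine ⟨k, fun F T r c hF => ?_⟩
  obtain ⟨f, hG, hf⟩ := hF.exists_outputs
  have hT : ∀ n, ∀ x ∈ cube n, ∀ ρ ∈ cube (r n), (f x ρ).toFinset.card = T n := by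
    intro n x hx ρ hρ
    rw [mem_cube] at hx hρ
    obtain ⟨L, hL, hc⟩ := hF.halts x ρ (by rw [hρ, hx])
    rw [Part.mem_unique (hf x ρ (by rw [hρ, hx])) hL, hc, hx]
  have hh : Computable fun n => k + c n :=
    Primrec.nat_add.to_comp.comp (Computable.const k) hF.computable_c
  by_contra hfail
  rw [not_eventually] at hfail
  -- Traps for all `n` form one enumerable set. At a failing `n` it contains at least `(n - 4) / 8`
  -- lengths below `n`, which exceeds `Nat.log 2 n + m` since `16 * Nat.log 2 n ≤ n` and `n ≥ 16 * m
  -- + 137`.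
  obtain ⟨s, S, ⟨n, R, ht⟩, hS⟩ := hk _ (rePred_trap hG hh) fun m => by
    obtain ⟨n, hn, hfn⟩ := (frequently_atTop.1 hfail) (128 + 16 * m + 9)
    refine ⟨n, (Finset.Ico (n / 4) (n / 2)).filter fun s => ∃ S R,
      Trap (fun x => (strings (r x.length)).map (f x)) (k + c n) n s S R, fun s hs => ?_, ?_⟩
    · obtain ⟨hs, S, R, h⟩ := Finset.mem_filter.1 hs
      rw [Finset.mem_Ico] at hs
      exact ⟨by omega, S, n, R, h⟩
    · have hdense : n ≤ 8 * ((Finset.Ico (n / 4) (n / 2)).filter fun s => ∃ S R,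
          Trap (fun x => (strings (r x.length)).map (f x)) (k + c n) n s S R).card + 4 := by
        rw [not_and_or, not_lt, not_lt] at hfn
        rcases hfn with h | h
        · exact card_trapping_of_sq_le (hT n) (by omega) h
        · exact card_trapping_of_mul_le (hT n) (by omega) h
      have := sixteen_mul_log_le (n := n) (by omega)
      omega
  obtain ⟨x, hx, hxk⟩ := hF.exists_complex_of_trap hf ht
  obtain ⟨p, hp, hpl⟩ := hS ht.1.le x hx
  exact absurd (hxk p hp) (by omega)

/-! ### Passing to logarithms -/

section Logarithms

open Real

theorem logb_two_pow (j : ℕ) : logb 2 ((2 : ℝ) ^ j) = j := by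
  rw [logb_pow, logb_self_eq_one (by norm_num), mul_one]

theorem logb_two_mono {x y : ℝ} (hx : 0 < x) (h : x ≤ y) : logb 2 x ≤ logb 2 y :=
  logb_le_logb_of_le (by norm_num) hx h

/-- The bound on the number of random bits. -/
theorem random_bits_bound {n k c T r j : ℕ} (hn : 0 < n)
    (h : n ^ 2 < 64 * (k + c + 4) ^ 2 * (T * 2 ^ min r j)) :
    2 * logb 2 n - logb 2 T - 2 * logb 2 (max c 1 : ℕ) - (6 + 2 * logb 2 (k + 5)) ≤ r := by
  have hT : T ≠ 0 := by
    rintro rfl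
    simp at h
  set M := max c 1 with hM
  have hM1 : 1 ≤ M := le_max_right _ _
  have hM2 : c ≤ M := le_max_left _ _
  have h1 : n ^ 2 ≤ 2 ^ 6 * ((k + 5) * M) ^ 2 * (T * 2 ^ r) := by
    refine h.le.trans ?_
    have h2 : k + c + 4 ≤ (k + 5) * M := by nlinarith
    have h3 : 2 ^ min r j ≤ 2 ^ r := Nat.pow_le_pow_right (by norm_num) (min_le_left _ _)
    gcongr
    norm_num
  have h2 : ((n : ℝ)) ^ 2 ≤ 2 ^ 6 * ((k + 5) * M) ^ 2 * (T * 2 ^ r) := by exact_mod_cast h1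
  have hn' : (n : ℝ) ≠ 0 := by positivity
  have hT' : (T : ℝ) ≠ 0 := by exact_mod_cast hT
  have hM' : (M : ℝ) ≠ 0 := by positivity
  have hk' : (k : ℝ) + 5 ≠ 0 := by positivity
  have h3 := logb_two_mono (by positivity) h2
  rw [logb_pow, logb_mul (by positivity) (by positivity), logb_mul (by positivity) (by positivity),
    logb_two_pow, logb_pow, logb_mul hk' hM', logb_mul hT' (by positivity), logb_two_pow] at h3
  push_cast at h3
  linarith

/-- The bound on the closeness. -/
theorem closeness_bound {n k c T r : ℕ} (hnT : 2 ≤ (n : ℝ) ^ 2 / T)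
    (h : n ^ 2 < 64 * (k + c + 4) ^ 2 * (T * 2 ^ min r (k + c + 5))) :
    logb 2 ((n : ℝ) ^ 2 / T) - 2 * logb 2 (logb 2 ((n : ℝ) ^ 2 / T)) -
      (k + 11 + 2 * logb 2 (k + 5)) ≤ c := by
  have hT : T ≠ 0 := by
    rintro rfl
    simp at h
  have hT' : (0 : ℝ) < T := by positivity
  set z := logb 2 ((n : ℝ) ^ 2 / T) with hz
  have hz1 : 1 ≤ z := by
    have := logb_two_mono (by norm_num) hnT
    rwa [logb_self_eq_one (by norm_num)] at this
  have hk0 : 0 ≤ logb 2 ((k : ℝ) + 5) :=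
    logb_nonneg (by norm_num) (by linarith [(Nat.cast_nonneg k : (0 : ℝ) ≤ k)])
  have hk1 : (0 : ℝ) ≤ k := Nat.cast_nonneg k
  have hlz : 0 ≤ logb 2 z := logb_nonneg (by norm_num) hz1
  -- For `c > z` the bound is trivial; for `c ≤ z` the polynomial factor in `c` can be replaced by
  -- one in `z`.
  rcases le_or_gt (c : ℝ) z with hc | hc
  · have h1 : n ^ 2 ≤ 2 ^ 6 * (k + c + 4) ^ 2 * (T * 2 ^ (k + c + 5)) := by
      refine h.le.trans ?_
      have h3 : 2 ^ min r (k + c + 5) ≤ 2 ^ (k + c + 5) :=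
        Nat.pow_le_pow_right (by norm_num) (min_le_right _ _)
      gcongr
      norm_num
    have h2 : (n : ℝ) ^ 2 / T ≤ 2 ^ 6 * ((k + 5) * z) ^ 2 * 2 ^ (k + c + 5) := by
      rw [div_le_iff₀ hT']
      have h3 : (n : ℝ) ^ 2 ≤ 2 ^ 6 * (k + c + 4) ^ 2 * (T * 2 ^ (k + c + 5)) := by
        exact_mod_cast h1
      refine h3.trans ?_
      have h4 : (k : ℝ) + c + 4 ≤ (k + 5) * z := by nlinarith
      calc _ ≤ 2 ^ 6 * (((k : ℝ) + 5) * z) ^ 2 * (T * 2 ^ (k + c + 5)) := by gcongr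
        _ = _ := by ring
    have h3 := logb_two_mono (by linarith) h2
    rw [logb_mul (by positivity) (by positivity), logb_mul (by positivity) (by positivity),
      logb_two_pow, logb_two_pow, logb_pow, logb_mul (by positivity) (by positivity), ← hz] at h3
    push_cast at h3
    linarith
  · linarith

theorem tendsto_logb_two_natCast : Tendsto (fun n : ℕ => logb 2 (n : ℝ)) atTop atTop :=
  (tendsto_logb_atTop (by norm_num)).comp tendsto_natCast_atTop_atTop

theorem eventually_random_bits_bound {T r c : ℕ → ℕ} {K : ℝ} (hK : 0 ≤ K)
    (h : ∀ᶠ n : ℕ in atTop,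
      2 * logb 2 n - logb 2 (T n) - 2 * logb 2 (max (c n) 1 : ℕ) - K ≤ (r n : ℝ))
    (hT : ∀ᶠ n : ℕ in atTop, T n = n)
    (hc : (fun n : ℕ => (c n : ℝ)) =O[atTop] fun n : ℕ => logb 2 n) :
    ∃ B : ℝ, ∀ᶠ n : ℕ in atTop, logb 2 n - B * logb 2 (logb 2 n) ≤ (r n : ℝ) := by
  obtain ⟨C, hC, hcC⟩ := hc.exists_pos
  have hC0 : 0 ≤ logb 2 (C + 1) := logb_nonneg (by norm_num) (by linarith)
  -- Once `logb 2 (logb 2 n) ≥ 1`, additive constants are absorbed into the multiple of it.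
  refine ⟨2 + 2 * logb 2 (C + 1) + K, ?_⟩
  filter_upwards [h, hT, hcC.bound, tendsto_logb_two_natCast.eventually_ge_atTop 1,
    ((tendsto_logb_atTop (b := 2) (by norm_num)).comp
      tendsto_logb_two_natCast).eventually_ge_atTop 1] with n hn hTn hcn hl hll
  simp only [Function.comp_apply] at hll
  rw [Real.norm_of_nonneg (Nat.cast_nonneg _), Real.norm_of_nonneg (by linarith)] at hcn
  have hmax : ((max (c n) 1 : ℕ) : ℝ) ≤ (C + 1) * logb 2 n := by
    push_cast
    exact max_le (by nlinarith) (by nlinarith)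
  have h1 := logb_two_mono (by positivity) hmax
  rw [logb_mul (by positivity) (by positivity)] at h1
  rw [hTn] at hn
  nlinarith

theorem eventually_closeness_bound {T c : ℕ → ℕ} {K : ℝ} (hT0 : ∀ᶠ n in atTop, 0 < T n)
    (h : ∀ᶠ n : ℕ in atTop, 2 ≤ (n : ℝ) ^ 2 / T n →
      logb 2 ((n : ℝ) ^ 2 / T n) - 2 * logb 2 (logb 2 ((n : ℝ) ^ 2 / T n)) - K ≤ (c n : ℝ))
    (hT : (fun n : ℕ => (T n : ℝ)) =O[atTop] fun n : ℕ => (n : ℝ)) :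
    ∃ B : ℝ, ∀ᶠ n : ℕ in atTop,
      logb 2 n - 2 * logb 2 (logb 2 n) - B ≤ (c n : ℝ) := by
  obtain ⟨C, hC, hTC⟩ := hT.exists_pos
  -- `logb 2 C` comes from `n ^ 2 / T n ≥ n / C`, and the 2 from `n ^ 2 / T n ≤ n ^ 2`, which raises
  -- the iterated logarithm by at most 1.
  refine ⟨logb 2 C + 2 + K, ?_⟩
  filter_upwards [h, hT0, hTC.bound, tendsto_natCast_atTop_atTop.eventually_ge_atTop (2 * C),
    tendsto_logb_two_natCast.eventually_ge_atTop 1, eventually_gt_atTop 0]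
    with n hn hT0n hTn hnC hl hn0
  rw [Real.norm_of_nonneg (Nat.cast_nonneg _), Real.norm_of_nonneg (Nat.cast_nonneg _)] at hTn
  have hT1 : (1 : ℝ) ≤ T n := by exact_mod_cast hT0n
  have hn1 : (0 : ℝ) < n := by exact_mod_cast hn0
  have h1 : (n : ℝ) / C ≤ (n : ℝ) ^ 2 / T n := by
    rw [div_le_div_iff₀ hC (by linarith)]
    nlinarith
  have h2 : 2 ≤ (n : ℝ) ^ 2 / T n := by
    refine le_trans ?_ h1
    rw [le_div_iff₀ hC]
    exact hnC
  have h3 := logb_two_mono (by positivity) h1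
  rw [logb_div hn1.ne' hC.ne'] at h3
  have h4 : logb 2 ((n : ℝ) ^ 2 / T n) ≤ 2 * logb 2 n := by
    have := logb_two_mono (by linarith) (div_le_self (by positivity : 0 ≤ (n : ℝ) ^ 2) hT1)
    rwa [logb_pow] at this
  have h5 : 1 ≤ logb 2 ((n : ℝ) ^ 2 / T n) := by
    have := logb_two_mono (by norm_num) h2
    rwa [logb_self_eq_one (by norm_num)] at this
  have h6 := logb_two_mono (by linarith) h4
  rw [logb_mul (by norm_num) (by linarith), logb_self_eq_one (by norm_num)] at h6
  have := hn h2
  linarith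

end Logarithms

end ShortPrograms

open ShortPrograms in
theorem theorem5p1 (U : List Bool →. List Bool) (hU : ShortPrograms.IsStandard U) :
    ∃ K a : ℝ, 0 < a ∧
      ∀ (F : List Bool × List Bool →. List (List Bool)) (T r c : ℕ → ℕ),
        ShortPrograms.ListApproximates U F T r c →
          -- part (1) and its special case
          (∀ᶠ n : ℕ in atTop,
            2 * Real.logb 2 n - Real.logb 2 (T n) - 2 * Real.logb 2 (max (c n) 1 : ℕ) - K
              ≤ (r n : ℝ)) ∧
          ((∀ᶠ n : ℕ in atTop, T n = n) →
            (fun n : ℕ => (c n : ℝ)) =O[atTop] (fun n : ℕ => Real.logb 2 n) →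
              ∃ B : ℝ, ∀ᶠ n : ℕ in atTop,
                Real.logb 2 n - B * Real.logb 2 (Real.logb 2 n) ≤ (r n : ℝ)) ∧
          -- part (2) and its special case
          (∀ᶠ n : ℕ in atTop, 2 ≤ (n : ℝ) ^ 2 / T n →
            Real.logb 2 ((n : ℝ) ^ 2 / T n)
                - 2 * Real.logb 2 (Real.logb 2 ((n : ℝ) ^ 2 / T n)) - K
              ≤ (c n : ℝ)) ∧
          ((fun n : ℕ => (T n : ℝ)) =O[atTop] (fun n : ℕ => (n : ℝ)) →
            ∃ B : ℝ, ∀ᶠ n : ℕ in atTop,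
              Real.logb 2 n - 2 * Real.logb 2 (Real.logb 2 n) - B ≤ (c n : ℝ)) ∧
          -- part (3)
          (∀ᶠ n : ℕ in atTop, a * ((n : ℝ) / ((c n : ℝ) + 1)) ≤ (T n : ℝ)) := by
  obtain ⟨k, hk⟩ := exists_bounds hU
  have hk0 : (0 : ℝ) ≤ k := Nat.cast_nonneg k
  have hK : 0 ≤ k + 11 + 2 * Real.logb 2 ((k : ℝ) + 5) := by
    have : 0 ≤ Real.logb 2 ((k : ℝ) + 5) := Real.logb_nonneg (by norm_num) (by linarith)
    positivity
  -- The first constant serves both logarithmic bounds; the second comes from `k + c + 4 ≤ (k + 4)(c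
  -- + 1)`.
  refine ⟨k + 11 + 2 * Real.logb 2 (k + 5), 1 / (64 * (k + 4)), by positivity,
    fun F T r c hF => ?_⟩
  have hb := hk F T r c hF
  have h1 : ∀ᶠ n : ℕ in atTop, 2 * Real.logb 2 n - Real.logb 2 (T n) -
      2 * Real.logb 2 (max (c n) 1 : ℕ) - (k + 11 + 2 * Real.logb 2 (k + 5)) ≤ (r n : ℝ) := by
    filter_upwards [hb, eventually_gt_atTop 0] with n hn hn0
    have := random_bits_bound hn0 hn.1
    linarith
  have h2 : ∀ᶠ n : ℕ in atTop, 2 ≤ (n : ℝ) ^ 2 / T n →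
      Real.logb 2 ((n : ℝ) ^ 2 / T n) - 2 * Real.logb 2 (Real.logb 2 ((n : ℝ) ^ 2 / T n)) -
        (k + 11 + 2 * Real.logb 2 (k + 5)) ≤ (c n : ℝ) := by
    filter_upwards [hb] with n hn hnT
    exact closeness_bound hnT hn.1
  refine ⟨h1, eventually_random_bits_bound hK h1, h2, eventually_closeness_bound ?_ h2, ?_⟩
  · filter_upwards [hb] with n hn
    refine Nat.pos_of_ne_zero fun h0 => ?_
    simp [h0] at hn
  · filter_upwards [hb] with n hn
    have h3 : (n : ℝ) ≤ 64 * (k + c n + 4) * T n := by exact_mod_cast hn.2.le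
    have hc0 : (0 : ℝ) ≤ c n := Nat.cast_nonneg _
    rw [div_mul_div_comm, one_mul, div_le_iff₀ (by positivity)]
    refine h3.trans ?_
    have h4 : 64 * ((k : ℝ) + c n + 4) ≤ 64 * (k + 4) * (c n + 1) := by nlinarith
    calc _ ≤ 64 * ((k : ℝ) + 4) * (c n + 1) * T n := by gcongr
      _ = _ := by ring
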